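/- All quantum systems are finite-dimensional and logarithms are to base $2$. A state (density operator) is a positive semidefinite operator of trace one, a quantum channel is a linear completely positive trace-preserving map, and a POVM on a system $S$ is a finite family of positive semidefinite operators on $S$ that sum to the identity. A state $\rho_{AB}$ is \emph{separable} if it is a finite convex combination of product states $\sigma_A\otimes\tau_B$, and \emph{entangled} otherwise. It is \emph{distillable} if for every $\varepsilon>0$ there are $n$ and a finite-round protocol of local operations and classical communication (LOCC) $L$ that maps $\rho_{AB}^{\otimes n}$ to a two-qubit state with $\langle\Phi^+|L(\rho_{AB}^{\otimes n})|\Phi^+\rangle\ge 1-\varepsilon$, where $|\Phi^+\rangle=(|00\rangle+|11\rangle)/\sqrt2$. It is \emph{bound entangled} if it is entangled but not distillable. An $N$-message dense coding protocol from Bob to Alice consists of a shared state $\rho_{AB}$, quantum channels $\mathcal D^i\colon B\to C$ ($i=1,\dots,N$) by which Bob encodes the message $i$ into his system, and a POVM $\{\Pi^i_{AC}\}_{i=1}^N$ by which Alice decodes after $C$ has been sent to her through a noiseless quantum channel of dimension $d=|C|$. Its signal states are $\omega^i_{AC}=(\mathrm{id}_A\otimes\mathcal D^i)(\rho_{AB})$.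 For an ensemble $\mathcal E=(p_i,\omega^i_{AC})_{i=1}^N$ and a POVM $M=\{M_y\}_y$, let $I(\mathcal E,M)=H(X)+H(Y)-H(XY)$ be the mutual information of the pair $(X,Y)$ with joint distribution $p_i\operatorname{tr}(M_y\omega^i_{AC})$, where $H$ is the Shannon entropy; the accessible information is $I(\mathcal E)=\sup_M I(\mathcal E,M)$ over all POVMs $M$ on $AC$ with finitely many outcomes. \textbf{Corollary.} Consider any dense coding protocol whose shared state $\rho_{AB}$ is bound entangled. Then for every probability distribution $(p_i)_{i=1}^N$ of the messages (in particular the uniform one) the ensemble $\mathcal E=(p_i,\omega^i_{AC})_{i=1}^N$ has finite accessible information, and $$I(\mathcal E)\le\log d .$$ -/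

import Mathlib

open scoped Kronecker Matrix ComplexOrder

/-! Quantum systems are finite-dimensional: the system with orthonormal basis indexed by a finite
type `A` is `ℂ^A`, its operators are `Matrix A A ℂ`, the composite of `A` and `B` has basis
`A × B`, and `|A| = Fintype.card A`. -/

/-- Density operators: positive semidefinite with trace one. -/
def IsDensity {S : Type} [Fintype S] (ρ : Matrix S S ℂ) : Prop :=
  ρ.PosSemidef ∧ ρ.trace = 1

/-- The action `id_R ⊗ E` of a linear map `E : 𝓑(B) → 𝓑(C)` on operators on `RB`. -/
def idTensor (R : Type) {B C : Type} (E : Matrix B B ℂ →ₗ[ℂ] Matrix C C ℂ)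
    (X : Matrix (R × B) (R × B) ℂ) : Matrix (R × C) (R × C) ℂ :=
  Matrix.of fun x y => E (Matrix.of fun b b' => X (x.1, b) (y.1, b')) x.2 y.2

/-- A quantum channel `B → C`: linear, completely positive and trace preserving. -/
structure QuantumChannel (B C : Type) [Fintype B] [Fintype C] where
  /-- the underlying linear map -/
  map : Matrix B B ℂ →ₗ[ℂ] Matrix C C ℂ
  completelyPositive : ∀ (k : ℕ) (X : Matrix (Fin k × B) (Fin k × B) ℂ),
    X.PosSemidef → (idTensor (Fin k) map X).PosSemidef
  tracePreserving : ∀ X : Matrix B B ℂ, (map X).trace = X.trace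

/-- A positive operator-valued measure on the system `S` with outcomes in `Y`. -/
structure POVM (Y S : Type) [Fintype Y] [Fintype S] [DecidableEq S] where
  /-- the effect of each outcome -/
  effect : Y → Matrix S S ℂ
  posSemidef : ∀ y, (effect y).PosSemidef
  sum_eq_one : ∑ y, effect y = 1

/-! ### Entanglement and distillability -/

/-- A bipartite state is separable if it is a finite convex combination of product states. -/
def IsSeparableState {A B : Type} [Fintype A] [Fintype B]
    (ρ : Matrix (A × B) (A × B) ℂ) : Prop :=
  ∃ (m : ℕ) (q : Fin m → ℝ) (σ : Fin m → Matrix A A ℂ) (τ : Fin m → Matrix B B ℂ),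
    (∀ k, 0 ≤ q k) ∧ ∑ k, q k = 1 ∧ (∀ k, IsDensity (σ k)) ∧ (∀ k, IsDensity (τ k)) ∧
      ρ = ∑ k, (q k : ℂ) • (σ k ⊗ₖ τ k)

/-- `IsLOCC A' B' A B L`: the map `L : 𝓑(AB) → 𝓑(A'B')` is implemented by a protocol of local
operations and classical communication with finitely many rounds. Either nothing is (any longer)
done, or one party makes a generalized measurement with Kraus operators `K i` on its system and
announces the outcome `i`, whereupon the parties go on with an LOCC protocol `L i` that may depend
on `i`. The system of the measuring party after the measurement may be of any dimension, so this
includes adding ancillas, discarding subsystems and (by ignoring `i`) arbitrary local channels. -/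
inductive IsLOCC (A' B' : Type) [Fintype A'] [DecidableEq A'] [Fintype B'] [DecidableEq B'] :
    ∀ (A B : Type) [Fintype A] [DecidableEq A] [Fintype B] [DecidableEq B],
      (Matrix (A × B) (A × B) ℂ → Matrix (A' × B') (A' × B') ℂ) → Prop
  | done : IsLOCC A' B' A' B' (fun X => X)
  | alice {A B : Type} [Fintype A] [DecidableEq A] [Fintype B] [DecidableEq B]
      {ι : Type} [Fintype ι] {A₁ : ι → Type} [∀ i, Fintype (A₁ i)] [∀ i, DecidableEq (A₁ i)]
      (K : ∀ i, Matrix (A₁ i) A ℂ) (hK : ∑ i, (K i)ᴴ * K i = 1)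
      (L : ∀ i, Matrix (A₁ i × B) (A₁ i × B) ℂ → Matrix (A' × B') (A' × B') ℂ)
      (hL : ∀ i, IsLOCC A' B' (A₁ i) B (L i)) :
      IsLOCC A' B' A B (fun X => ∑ i,
        L i ((K i ⊗ₖ (1 : Matrix B B ℂ)) * X * (K i ⊗ₖ (1 : Matrix B B ℂ))ᴴ))
  | bob {A B : Type} [Fintype A] [DecidableEq A] [Fintype B] [DecidableEq B]
      {ι : Type} [Fintype ι] {B₁ : ι → Type} [∀ i, Fintype (B₁ i)] [∀ i, DecidableEq (B₁ i)]
      (K : ∀ i, Matrix (B₁ i) B ℂ) (hK : ∑ i, (K i)ᴴ * K i = 1)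
      (L : ∀ i, Matrix (A × B₁ i) (A × B₁ i) ℂ → Matrix (A' × B') (A' × B') ℂ)
      (hL : ∀ i, IsLOCC A' B' A (B₁ i) (L i)) :
      IsLOCC A' B' A B (fun X => ∑ i,
        L i (((1 : Matrix A A ℂ) ⊗ₖ K i) * X * ((1 : Matrix A A ℂ) ⊗ₖ K i)ᴴ))

/-- `n` copies of a bipartite state, `ρ^{⊗n}`, seen as a bipartite state on `A^n` and `B^n`. -/
def copies {A B : Type} (n : ℕ) (ρ : Matrix (A × B) (A × B) ℂ) :
    Matrix ((Fin n → A) × (Fin n → B)) ((Fin n → A) × (Fin n → B)) ℂ :=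
  Matrix.of fun x y => ∏ k, ρ (x.1 k, x.2 k) (y.1 k, y.2 k)

/-- The maximally entangled two-qubit vector `(|00⟩ + |11⟩) / √2`. -/
noncomputable def bellVector : Fin 2 × Fin 2 → ℂ :=
  fun x => if x.1 = x.2 then ((1 / Real.sqrt 2 : ℝ) : ℂ) else 0

/-- The fidelity `⟨Φ⁺| σ |Φ⁺⟩` of a two-qubit state with the maximally entangled state. -/
noncomputable def bellFidelity (σ : Matrix (Fin 2 × Fin 2) (Fin 2 × Fin 2) ℂ) : ℝ :=
  (star bellVector ⬝ᵥ (σ *ᵥ bellVector)).re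

/-- A bipartite state is distillable if, from sufficiently many copies of it, LOCC can produce a
maximally entangled two-qubit state with fidelity arbitrarily close to one. -/
def IsDistillable {A B : Type} [Fintype A] [DecidableEq A] [Fintype B] [DecidableEq B]
    (ρ : Matrix (A × B) (A × B) ℂ) : Prop :=
  ∀ ε : ℝ, 0 < ε → ∃ (n : ℕ)
    (L : Matrix ((Fin n → A) × (Fin n → B)) ((Fin n → A) × (Fin n → B)) ℂ →
      Matrix (Fin 2 × Fin 2) (Fin 2 × Fin 2) ℂ),
    IsLOCC (Fin 2) (Fin 2) (Fin n → A) (Fin n → B) L ∧ 1 - ε ≤ bellFidelity (L (copies n ρ))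

/-- Bound entangled: entangled, but not distillable. -/
def IsBoundEntangled {A B : Type} [Fintype A] [DecidableEq A] [Fintype B] [DecidableEq B]
    (ρ : Matrix (A × B) (A × B) ℂ) : Prop :=
  IsDensity ρ ∧ ¬ IsSeparableState ρ ∧ ¬ IsDistillable ρ

/-! ### Accessible information (logarithms to base two) -/

/-- The Shannon entropy of a finitely supported probability distribution. -/
noncomputable def shannonEntropy {X : Type} [Fintype X] (p : X → ℝ) : ℝ :=
  -∑ x, p x * Real.logb 2 (p x)

/-- The mutual information `H(X) + H(Y) - H(XY)` of a joint distribution. -/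
noncomputable def mutualInformation {X Y : Type} [Fintype X] [Fintype Y] (p : X × Y → ℝ) : ℝ :=
  shannonEntropy (fun x => ∑ y, p (x, y)) + shannonEntropy (fun y => ∑ x, p (x, y))
    - shannonEntropy p

/-- The information `I(𝓔, M)` that the measurement `M` extracts from the ensemble
`𝓔 = (p x, ω x)`: the mutual information of the distribution `p x * tr (M y * ω x)`. -/
noncomputable def measuredInformation {X Y S : Type} [Fintype X] [Fintype Y] [Fintype S]
    [DecidableEq S] (p : X → ℝ) (ω : X → Matrix S S ℂ) (M : POVM Y S) : ℝ :=
  mutualInformation fun z : X × Y => p z.1 * (M.effect z.2 * ω z.1).trace.re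

/-- The set of the values `I(𝓔, M)`, over all measurements `M` with finitely many outcomes. -/
def measuredInformationValues {X S : Type} [Fintype X] [Fintype S] [DecidableEq S]
    (p : X → ℝ) (ω : X → Matrix S S ℂ) : Set ℝ :=
  {I | ∃ (k : ℕ) (M : POVM (Fin k) S), I = measuredInformation p ω M}

/-- The accessible information of the ensemble `(p x, ω x)`. -/
noncomputable def accessibleInformation {X S : Type} [Fintype X] [Fintype S] [DecidableEq S]
    (p : X → ℝ) (ω : X → Matrix S S ℂ) : ℝ :=
  sSup (measuredInformationValues p ω)

/-! ### Dense coding -/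

/-- An `N`-message dense coding protocol from Bob to Alice. They share the state `ρ` on `AB`; Bob
encodes the message `i` by applying the channel `encoder i : B → C` to his system, sends `C` to
Alice through a noiseless `|C|`-dimensional channel, and Alice measures `AC` with `decoder`. -/
structure DenseCodingProtocol (A B C : Type) [Fintype A] [DecidableEq A] [Fintype B]
    [DecidableEq B] [Fintype C] [DecidableEq C] (N : ℕ) where
  /-- the shared state -/
  ρ : Matrix (A × B) (A × B) ℂ
  isDensity : IsDensity ρ
  /-- Bob's encoding operations -/
  encoder : Fin N → QuantumChannel B C
  /-- Alice's measurement -/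
  decoder : POVM (Fin N) (A × C)

/-- The signal states `ω i = (id_A ⊗ encoder i)(ρ)` on `AC` that Alice has to distinguish. -/
def DenseCodingProtocol.signal {A B C : Type} [Fintype A] [DecidableEq A] [Fintype B]
    [DecidableEq B] [Fintype C] [DecidableEq C] {N : ℕ} (P : DenseCodingProtocol A B C N)
    (i : Fin N) : Matrix (A × C) (A × C) ℂ :=
  idTensor A (P.encoder i).map P.ρ

/-! ### Local operators -/

-- The theorem rests on the reduction criterion: an undistillable `ρ` satisfies `ω ≤ ρ_A ⊗ 1` for
-- every signal state `ω`, where `ρ_A` is the reduced state of Alice. All conditional outcome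
-- distributions `tr (M_y ω^i)` are then dominated by one measure `s(y) = tr (M_y (ρ_A ⊗ 1))`. Its
-- total mass is `tr (ρ_A ⊗ 1) = d`, and comparing the output distribution with `s / d` bounds the
-- mutual information by `log d` (`mutualInformation_le_logb`).
--
-- The criterion is proved by contraposition. The expectation of `ω_A ⊗ 1 - ω` in any vector is half
-- a sum, over pairs of basis vectors of `C`, of the quantities `tr σ - 2 ⟨Φ⁺|σ|Φ⁺⟩` for two-qubit
-- operators `σ` obtained by local filters (`sum_fidelityDefect`). A violation thus makes one of
-- them negative. Kraus operators of an encoding can be absorbed into Bob's filter, so the same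
-- holds after any channel on his side (`trace_mul_idTensor_le`).
--
-- A filtered two-qubit state of fidelity above one half is purified by two recurrence steps with a
-- Hadamard rotation between them: the first suppresses bit errors, the second suppresses phase
-- errors (`exists_filtersTo_of_fidelity`). These steps succeed only with positive probability.
-- Scaling the filters down to genuine measurements and repeating them on fresh blocks of copies
-- gives a finite LOCC protocol whose chance of total failure is arbitrarily small
-- (`isDistillable_of_filtersTo`).

open scoped MatrixOrder in
theorem Matrix.PosSemidef.exists_eq_conjTranspose_mul_self {n : Type*} [Fintype n] [DecidableEq n]
    {M : Matrix n n ℂ} (hM : M.PosSemidef) : ∃ Y : Matrix n n ℂ, M = Yᴴ * Y :=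
  CStarAlgebra.nonneg_iff_eq_star_mul_self.mp hM.nonneg

/-- The operator `(K ⊗ Q) X (K ⊗ Q)†` obtained from `X` by the local operators `K` and `Q`. -/
def localConj {A A₁ B B₁ : Type} [Fintype A] [Fintype B] (K : Matrix A₁ A ℂ) (Q : Matrix B₁ B ℂ)
    (X : Matrix (A × B) (A × B) ℂ) : Matrix (A₁ × B₁) (A₁ × B₁) ℂ :=
  (K ⊗ₖ Q) * X * (K ⊗ₖ Q)ᴴ

section localConj

variable {A A₁ A₂ B B₁ B₂ : Type} [Fintype A] [Fintype B]

theorem localConj_localConj [Fintype A₁] [Fintype B₁] (K' : Matrix A₂ A₁ ℂ) (Q' : Matrix B₂ B₁ ℂ)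
    (K : Matrix A₁ A ℂ) (Q : Matrix B₁ B ℂ) (X : Matrix (A × B) (A × B) ℂ) :
    localConj K' Q' (localConj K Q X) = localConj (K' * K) (Q' * Q) X := by
  simp only [localConj, Matrix.mul_kronecker_mul, Matrix.conjTranspose_mul, Matrix.mul_assoc]

theorem localConj_apply (K : Matrix A₁ A ℂ) (Q : Matrix B₁ B ℂ) (X : Matrix (A × B) (A × B) ℂ)
    (x y : A₁ × B₁) :
    localConj K Q X x y = ∑ a', ∑ b', (∑ a, ∑ b, K x.1 a * Q x.2 b * X (a, b) (a', b')) *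
      (star (K y.1 a') * star (Q y.2 b')) := by
  simp [localConj, Matrix.mul_apply, Fintype.sum_prod_type]

theorem localConj_sum {ι : Type*} (s : Finset ι) (K : Matrix A₁ A ℂ) (Q : Matrix B₁ B ℂ)
    (X : ι → Matrix (A × B) (A × B) ℂ) :
    localConj K Q (∑ i ∈ s, X i) = ∑ i ∈ s, localConj K Q (X i) := by
  simp [localConj, Matrix.mul_sum, Matrix.sum_mul]

theorem localConj_smul_smul (r : ℝ) (K : Matrix A₁ A ℂ) (Q : Matrix B₁ B ℂ)
    (X : Matrix (A × B) (A × B) ℂ) :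
    localConj ((r : ℂ) • K) ((r : ℂ) • Q) X = ((r ^ 4 : ℝ) : ℂ) • localConj K Q X := by
  simp only [localConj, Matrix.smul_kronecker, Matrix.kronecker_smul, Matrix.conjTranspose_smul,
    Matrix.smul_mul, Matrix.mul_smul, smul_smul]
  congr 1
  simp
  ring

theorem Matrix.PosSemidef.localConj [Fintype A₁] [Fintype B₁]
    {X : Matrix (A × B) (A × B) ℂ} (hX : X.PosSemidef) (K : Matrix A₁ A ℂ) (Q : Matrix B₁ B ℂ) : (localConj K Q X).PosSemidef :=
  hX.mul_mul_conjTranspose_same _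

theorem localConj_one_submatrix [DecidableEq A] [DecidableEq B] (f : A₁ → A) (g : B₁ → B)
    (X : Matrix (A × B) (A × B) ℂ) :
    localConj ((1 : Matrix A A ℂ).submatrix f id) ((1 : Matrix B B ℂ).submatrix g id) X =
      X.submatrix (Prod.map f g) (Prod.map f g) := by
  have h : (1 : Matrix A A ℂ).submatrix f id ⊗ₖ (1 : Matrix B B ℂ).submatrix g id =
      (1 : Matrix (A × B) (A × B) ℂ).submatrix (Prod.map f g) id := by
    rw [← Matrix.one_kronecker_one]; rfl
  rw [localConj, h]
  ext x y
  simp [Matrix.mul_apply, Matrix.one_apply]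

theorem trace_localConj [Fintype A₁] [Fintype B₁] [DecidableEq A] [DecidableEq B]
    (K : Matrix A₁ A ℂ) (Q : Matrix B₁ B ℂ) (X : Matrix (A × B) (A × B) ℂ) :
    (localConj K Q X).trace = (((Kᴴ * K) ⊗ₖ (Qᴴ * Q)) * X).trace := by
  rw [localConj, Matrix.trace_mul_comm, ← Matrix.mul_assoc, Matrix.conjTranspose_kronecker,
    Matrix.mul_kronecker_mul]

theorem sum_trace_localConj [DecidableEq A] [DecidableEq B] {ι κ : Type} [Fintype ι] [Fintype κ]
    [Fintype A₁] [Fintype B₁] (K : ι → Matrix A₁ A ℂ) (hK : ∑ i, (K i)ᴴ * K i = 1)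
    (Q : κ → Matrix B₁ B ℂ) (hQ : ∑ i, (Q i)ᴴ * Q i = 1) (X : Matrix (A × B) (A × B) ℂ) :
    ∑ i, ∑ j, (localConj (K i) (Q j) X).trace = X.trace := by
  have h : ∑ i, ∑ j, ((K i)ᴴ * K i) ⊗ₖ ((Q j)ᴴ * Q j) = (1 : Matrix (A × B) (A × B) ℂ) := by
    rw [← Matrix.one_kronecker_one, ← hK, ← hQ]
    ext x y
    simp [Matrix.sum_apply, Finset.sum_mul_sum]
  simp only [trace_localConj, ← Matrix.trace_sum, ← Matrix.sum_mul, h, Matrix.one_mul]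

end localConj

/-! ### Products and powers of bipartite operators -/

/-- The product of two bipartite operators, seen as a bipartite operator. -/
def bipartiteProd {A B R S : Type} (ρ : Matrix (A × B) (A × B) ℂ) (τ : Matrix (R × S) (R × S) ℂ) :
    Matrix ((A × R) × (B × S)) ((A × R) × (B × S)) ℂ :=
  (ρ ⊗ₖ τ).submatrix (Equiv.prodProdProdComm A R B S) (Equiv.prodProdProdComm A R B S)

theorem localConj_bipartiteProd {A B R S A₁ B₁ R₁ S₁ : Type} [Fintype A] [Fintype B] [Fintype R]
    [Fintype S] (K : Matrix A₁ A ℂ) (Q : Matrix B₁ B ℂ) (K' : Matrix R₁ R ℂ) (Q' : Matrix S₁ S ℂ)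
    (ρ : Matrix (A × B) (A × B) ℂ) (τ : Matrix (R × S) (R × S) ℂ) :
    localConj (K ⊗ₖ K') (Q ⊗ₖ Q') (bipartiteProd ρ τ) =
      bipartiteProd (localConj K Q ρ) (localConj K' Q' τ) := by
  have h : (K ⊗ₖ K') ⊗ₖ (Q ⊗ₖ Q') = ((K ⊗ₖ Q) ⊗ₖ (K' ⊗ₖ Q')).submatrix
      (Equiv.prodProdProdComm A₁ R₁ B₁ S₁) (Equiv.prodProdProdComm A R B S) := by
    ext x y
    simp only [Matrix.kroneckerMap_apply, Matrix.submatrix_apply, Equiv.prodProdProdComm_apply]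
    ring
  simp only [localConj, h, bipartiteProd, Matrix.conjTranspose_submatrix,
    Matrix.submatrix_mul_equiv, Matrix.mul_kronecker_mul, Matrix.conjTranspose_kronecker]

/-- The tensor power of a matrix over an arbitrary finite index type. -/
def piKron (ι : Type) [Fintype ι] {m n : Type} (M : Matrix m n ℂ) : Matrix (ι → m) (ι → n) ℂ :=
  Matrix.of fun x y => ∏ k, M (x k) (y k)

/-- The tensor power of a bipartite operator, seen as a bipartite operator. -/
def bipartitePow (ι : Type) [Fintype ι] {A B : Type} (ρ : Matrix (A × B) (A × B) ℂ) :
    Matrix ((ι → A) × (ι → B)) ((ι → A) × (ι → B)) ℂ :=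
  (piKron ι ρ).submatrix (Equiv.arrowProdEquivProdArrow ι (fun _ => A) (fun _ => B)).symm
    (Equiv.arrowProdEquivProdArrow ι (fun _ => A) (fun _ => B)).symm

section powers

variable {ι κ : Type} [Fintype ι] [Fintype κ] {l m n A A₁ B B₁ : Type}

theorem piKron_mul [DecidableEq ι] [Fintype m] (M : Matrix l m ℂ) (N : Matrix m n ℂ) :
    piKron ι (M * N) = piKron ι M * piKron ι N := by
  ext x y
  simp [piKron, Matrix.mul_apply, Fintype.prod_sum, Finset.prod_mul_distrib]

theorem piKron_conjTranspose (M : Matrix m n ℂ) : piKron ι Mᴴ = (piKron ι M)ᴴ := by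
  ext x y
  simp [piKron]

theorem piKron_kronecker (K : Matrix A₁ A ℂ) (Q : Matrix B₁ B ℂ) :
    (piKron ι (K ⊗ₖ Q)).submatrix (Equiv.arrowProdEquivProdArrow ι (fun _ => A₁) (fun _ => B₁)).symm
      (Equiv.arrowProdEquivProdArrow ι (fun _ => A) (fun _ => B)).symm =
      piKron ι K ⊗ₖ piKron ι Q := by
  ext x y
  simp [piKron, Equiv.arrowProdEquivProdArrow, Finset.prod_mul_distrib]

theorem bipartitePow_apply (ρ : Matrix (A × B) (A × B) ℂ) (x y : (ι → A) × (ι → B)) :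
    bipartitePow ι ρ x y = ∏ k, ρ (x.1 k, x.2 k) (y.1 k, y.2 k) := rfl

theorem Matrix.PosSemidef.bipartitePow [DecidableEq ι] [Fintype A] [Fintype B] [DecidableEq A]
    [DecidableEq B] {ρ : Matrix (A × B) (A × B) ℂ} (hρ : ρ.PosSemidef) :
    (bipartitePow ι ρ).PosSemidef := by
  obtain ⟨Y, rfl⟩ := hρ.exists_eq_conjTranspose_mul_self
  rw [_root_.bipartitePow, piKron_mul, piKron_conjTranspose]
  exact (Matrix.posSemidef_conjTranspose_mul_self _).submatrix _

theorem bipartitePow_localConj [DecidableEq ι] [Fintype A] [Fintype B] (K : Matrix A₁ A ℂ)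
    (Q : Matrix B₁ B ℂ) (X : Matrix (A × B) (A × B) ℂ) :
    bipartitePow ι (localConj K Q X) = localConj (piKron ι K) (piKron ι Q) (bipartitePow ι X) := by
  simp only [localConj, bipartitePow, ← piKron_kronecker, Matrix.conjTranspose_submatrix,
    Matrix.submatrix_mul_equiv, piKron_mul, piKron_conjTranspose]

theorem trace_bipartitePow [DecidableEq ι] [Fintype A] [Fintype B]
    (ρ : Matrix (A × B) (A × B) ℂ) :
    (bipartitePow ι ρ).trace = ρ.trace ^ Fintype.card ι := by
  have h : (piKron ι ρ).trace = ρ.trace ^ Fintype.card ι := by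
    rw [← Finset.card_univ, ← Finset.prod_const]
    exact (Fintype.prod_sum fun (_ : ι) a => ρ a a).symm
  rw [← h]
  exact Equiv.sum_comp (Equiv.arrowProdEquivProdArrow ι (fun _ => A) (fun _ => B)).symm
    fun x => piKron ι ρ x x

theorem bipartitePow_reindex (e : κ ≃ ι) (X : Matrix (A × B) (A × B) ℂ) :
    bipartitePow ι X = (bipartitePow κ X).submatrix
      (Prod.map (fun f => f ∘ e) (fun f => f ∘ e)) (Prod.map (fun f => f ∘ e) (fun f => f ∘ e)) := by
  ext x y
  simp only [bipartitePow_apply, Matrix.submatrix_apply, Prod.map_fst, Prod.map_snd,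
    Function.comp_apply]
  exact (Equiv.prod_comp e fun k => X (x.1 k, x.2 k) (y.1 k, y.2 k)).symm

theorem bipartitePow_bipartitePow (X : Matrix (A × B) (A × B) ℂ) :
    bipartitePow ι (bipartitePow κ X) = (bipartitePow (ι × κ) X).submatrix
      (Prod.map Function.uncurry Function.uncurry) (Prod.map Function.uncurry Function.uncurry) := by
  ext x y
  simp [bipartitePow_apply, Fintype.prod_prod_type, Function.uncurry]

theorem bipartitePow_fin_succ (n : ℕ) (X : Matrix (A × B) (A × B) ℂ) :
    bipartitePow (Fin (n + 1)) X = (bipartiteProd X (bipartitePow (Fin n) X)).submatrix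
      (Prod.map (fun f => (f 0, Fin.tail f)) (fun f => (f 0, Fin.tail f)))
      (Prod.map (fun f => (f 0, Fin.tail f)) (fun f => (f 0, Fin.tail f))) := by
  ext x y
  simp [bipartitePow_apply, bipartiteProd, Fin.prod_univ_succ, Fin.tail]

end powers

/-! ### LOCC protocols -/

theorem bellFidelity_eq (σ : Matrix (Fin 2 × Fin 2) (Fin 2 × Fin 2) ℂ) :
    bellFidelity σ =
      ((σ (0, 0) (0, 0)).re + (σ (0, 0) (1, 1)).re + (σ (1, 1) (0, 0)).re
        + (σ (1, 1) (1, 1)).re) / 2 := by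
  have h : Real.sqrt 2 ^ 2 = 2 := Real.sq_sqrt (by norm_num)
  simp only [bellFidelity, bellVector, dotProduct, Matrix.mulVec, Fintype.sum_prod_type,
    Fin.sum_univ_two, Pi.star_apply]
  simp only [Complex.add_re, Complex.mul_re]
  simp
  linear_combination ((σ (0, 0) (0, 0)).re + (σ (0, 0) (1, 1)).re + (σ (1, 1) (0, 0)).re
        + (σ (1, 1) (1, 1)).re) / 4 * h

theorem bellFidelity_smul (r : ℝ) (σ : Matrix (Fin 2 × Fin 2) (Fin 2 × Fin 2) ℂ) :
    bellFidelity ((r : ℂ) • σ) = r * bellFidelity σ := by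
  simp only [bellFidelity_eq, Matrix.smul_apply, smul_eq_mul, Complex.re_ofReal_mul]
  ring

theorem bellFidelity_nonneg {σ : Matrix (Fin 2 × Fin 2) (Fin 2 × Fin 2) ℂ} (hσ : σ.PosSemidef) :
    0 ≤ bellFidelity σ :=
  (Complex.le_def.mp (hσ.dotProduct_mulVec_nonneg bellVector)).1

namespace IsLOCC

variable {A' B' : Type} [Fintype A'] [DecidableEq A'] [Fintype B'] [DecidableEq B']

/-- Both parties measure, and the protocol goes on depending on both outcomes. -/
theorem localMeasure {A B A₁ B₁ ι κ : Type} [Fintype A] [DecidableEq A] [Fintype B] [DecidableEq B]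
    [Fintype A₁] [DecidableEq A₁] [Fintype B₁] [DecidableEq B₁] [Fintype ι] [Fintype κ]
    (K : ι → Matrix A₁ A ℂ) (hK : ∑ i, (K i)ᴴ * K i = 1)
    (Q : κ → Matrix B₁ B ℂ) (hQ : ∑ j, (Q j)ᴴ * Q j = 1)
    (L : ι → κ → Matrix (A₁ × B₁) (A₁ × B₁) ℂ → Matrix (A' × B') (A' × B') ℂ)
    (hL : ∀ i j, IsLOCC A' B' A₁ B₁ (L i j)) :
    IsLOCC A' B' A B fun X => ∑ i, ∑ j, L i j (localConj (K i) (Q j) X) := by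
  have h := IsLOCC.alice K hK _ fun i => IsLOCC.bob (A := A₁) Q hQ (L i) (hL i)
  have e : ∀ i j (X : Matrix (A × B) (A × B) ℂ),
      localConj (1 : Matrix A₁ A₁ ℂ) (Q j) (localConj (K i) (1 : Matrix B B ℂ) X) =
        localConj (K i) (Q j) X := fun i j X => by
    rw [localConj_localConj, Matrix.one_mul, Matrix.mul_one]
  simp only [← e]
  exact h

/-- Both parties apply an isometry before the protocol starts. -/
theorem comp_isometry {A B A₁ B₁ : Type} [Fintype A] [DecidableEq A] [Fintype B] [DecidableEq B]
    [Fintype A₁] [DecidableEq A₁] [Fintype B₁] [DecidableEq B₁]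
    (K : Matrix A₁ A ℂ) (hK : Kᴴ * K = 1) (Q : Matrix B₁ B ℂ) (hQ : Qᴴ * Q = 1)
    {L : Matrix (A₁ × B₁) (A₁ × B₁) ℂ → Matrix (A' × B') (A' × B') ℂ} (hL : IsLOCC A' B' A₁ B₁ L) :
    IsLOCC A' B' A B fun X => L (localConj K Q X) := by
  simpa using localMeasure (fun _ : Unit => K) (by simpa using hK) (fun _ : Unit => Q)
    (by simpa using hQ) (fun _ _ => L) fun _ _ => hL

/-- Both parties relabel their bases before the protocol starts. -/
theorem comp_submatrix {A B A₁ B₁ : Type} [Fintype A] [DecidableEq A] [Fintype B] [DecidableEq B]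
    [Fintype A₁] [DecidableEq A₁] [Fintype B₁] [DecidableEq B₁] (e : A₁ ≃ A) (g : B₁ ≃ B)
    {L : Matrix (A₁ × B₁) (A₁ × B₁) ℂ → Matrix (A' × B') (A' × B') ℂ} (hL : IsLOCC A' B' A₁ B₁ L) :
    IsLOCC A' B' A B fun X => L (X.submatrix (Prod.map e g) (Prod.map e g)) := by
  have h : ∀ {S S₁ : Type} [Fintype S] [DecidableEq S] [Fintype S₁] [DecidableEq S₁] (f : S₁ ≃ S),
      ((1 : Matrix S S ℂ).submatrix f id)ᴴ * (1 : Matrix S S ℂ).submatrix f id = 1 := by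
    intro S S₁ _ _ _ _ f
    rw [Matrix.conjTranspose_submatrix, Matrix.submatrix_mul_equiv]
    simp
  simpa only [localConj_one_submatrix] using
    comp_isometry ((1 : Matrix A A ℂ).submatrix e id) (h e) ((1 : Matrix B B ℂ).submatrix g id)
      (h g) hL

theorem isLinearMap {A B : Type} [Fintype A] [DecidableEq A] [Fintype B] [DecidableEq B]
    {L : Matrix (A × B) (A × B) ℂ → Matrix (A' × B') (A' × B') ℂ} (hL : IsLOCC A' B' A B L) :
    IsLinearMap ℂ L := by
  induction hL with
  | done => exact ⟨fun _ _ => rfl, fun _ _ => rfl⟩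
  | alice K hK L hL ih =>
    constructor
    · intro X Y
      simp only [Matrix.mul_add, Matrix.add_mul, (ih _).map_add, Finset.sum_add_distrib]
    · intro c X
      simp only [Matrix.mul_smul, Matrix.smul_mul, (ih _).map_smul, Finset.smul_sum]
  | bob K hK L hL ih =>
    constructor
    · intro X Y
      simp only [Matrix.mul_add, Matrix.add_mul, (ih _).map_add, Finset.sum_add_distrib]
    · intro c X
      simp only [Matrix.mul_smul, Matrix.smul_mul, (ih _).map_smul, Finset.smul_sum]

/-- The Kraus operators `⟨s| ⊗ 1` measure a subsystem in its basis; forgetting the outcome realizes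
the partial trace. -/
theorem sum_conjTranspose_mul_one_submatrix_left {S R : Type} [Fintype S] [DecidableEq S]
    [Fintype R] [DecidableEq R] :
    ∑ s : S, ((1 : Matrix (S × R) (S × R) ℂ).submatrix (fun r => (s, r)) id)ᴴ *
      (1 : Matrix (S × R) (S × R) ℂ).submatrix (fun r => (s, r)) id = 1 := by
  ext x y
  simp only [Matrix.sum_apply, Matrix.mul_apply, Matrix.conjTranspose_apply,
    Matrix.submatrix_apply]
  refine (Fintype.sum_prod_type' (f := fun s r => star ((1 : Matrix (S × R) (S × R) ℂ) (s, r) x) *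
    (1 : Matrix (S × R) (S × R) ℂ) (s, r) y)).symm.trans ?_
  simp [Matrix.one_apply, eq_comm]

theorem sum_conjTranspose_mul_one_submatrix_right {S R : Type} [Fintype S] [DecidableEq S]
    [Fintype R] [DecidableEq R] :
    ∑ r : R, ((1 : Matrix (S × R) (S × R) ℂ).submatrix (fun s => (s, r)) id)ᴴ *
      (1 : Matrix (S × R) (S × R) ℂ).submatrix (fun s => (s, r)) id = 1 := by
  ext x y
  simp only [Matrix.sum_apply, Matrix.mul_apply, Matrix.conjTranspose_apply,
    Matrix.submatrix_apply]
  refine (Fintype.sum_prod_type_right' (f := fun s r =>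
    star ((1 : Matrix (S × R) (S × R) ℂ) (s, r) x) *
      (1 : Matrix (S × R) (S × R) ℂ) (s, r) y)).symm.trans ?_
  simp [Matrix.one_apply, eq_comm]

section discard

variable {A B R S : Type} [Fintype A] [DecidableEq A] [Fintype B] [DecidableEq B] [Fintype R]
  [DecidableEq R] [Fintype S] [DecidableEq S]

/-- Discarding the second pair of systems. -/
theorem discard_right {L : Matrix (A × B) (A × B) ℂ → Matrix (A' × B') (A' × B') ℂ}
    (hL : IsLOCC A' B' A B L) :
    ∃ L', IsLOCC A' B' (A × R) (B × S) L' ∧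
      ∀ ρ τ, L' (bipartiteProd ρ τ) = τ.trace • L ρ := by
  refine ⟨_, localMeasure _ sum_conjTranspose_mul_one_submatrix_right _
    sum_conjTranspose_mul_one_submatrix_right (fun _ _ => L) fun _ _ => hL, fun ρ τ => ?_⟩
  simp only [localConj_one_submatrix]
  have h : ∀ (r : R) (s : S), (bipartiteProd ρ τ).submatrix
      (Prod.map (fun a => (a, r)) fun b => (b, s)) (Prod.map (fun a => (a, r)) fun b => (b, s)) =
      τ (r, s) (r, s) • ρ := by
    intro r s
    ext x y
    simp [bipartiteProd, mul_comm]
  simp only [h, hL.isLinearMap.map_smul, ← Finset.sum_smul]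
  rw [Matrix.trace, Fintype.sum_prod_type]
  rfl

/-- Discarding the first pair of systems. -/
theorem discard_left {L : Matrix (R × S) (R × S) ℂ → Matrix (A' × B') (A' × B') ℂ}
    (hL : IsLOCC A' B' R S L) :
    ∃ L', IsLOCC A' B' (A × R) (B × S) L' ∧
      ∀ ρ τ, L' (bipartiteProd ρ τ) = ρ.trace • L τ := by
  refine ⟨_, localMeasure _ sum_conjTranspose_mul_one_submatrix_left _
    sum_conjTranspose_mul_one_submatrix_left (fun _ _ => L) fun _ _ => hL, fun ρ τ => ?_⟩
  simp only [localConj_one_submatrix]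
  have h : ∀ (a : A) (b : B), (bipartiteProd ρ τ).submatrix
      (Prod.map (fun r => (a, r)) fun s => (b, s)) (Prod.map (fun r => (a, r)) fun s => (b, s)) =
      ρ (a, b) (a, b) • τ := by
    intro r s
    ext x y
    simp [bipartiteProd]
  simp only [h, hL.isLinearMap.map_smul, ← Finset.sum_smul]
  rw [Matrix.trace, Fintype.sum_prod_type]
  rfl

end discard

end IsLOCC

/-- The Kraus operators of a filter: `none` is success, and on failure the system is reset. -/
def filterKraus {A : Type} (K : Matrix (Fin 2) A ℂ) (R : Matrix A A ℂ) :
    Option A → Matrix (Fin 2) A ℂ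
  | none => K
  | some a => Matrix.of fun s x => if s = 0 then R a x else 0

theorem sum_filterKraus {A : Type} [Fintype A] (K : Matrix (Fin 2) A ℂ) (R : Matrix A A ℂ) :
    ∑ i, (filterKraus K R i)ᴴ * filterKraus K R i = Kᴴ * K + Rᴴ * R := by
  rw [Fintype.sum_option]
  congr 1
  ext x y
  simp [filterKraus, Matrix.sum_apply, Matrix.mul_apply]

/-- One attempt to filter a two-qubit state out of `ρ`, with the protocol `L` on `τ` to fall back
on in case of failure. -/
theorem IsLOCC.exists_filter_or_else {A B R S : Type} [Fintype A] [DecidableEq A] [Fintype B]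
    [DecidableEq B] [Fintype R] [DecidableEq R] [Fintype S] [DecidableEq S]
    (K : Matrix (Fin 2) A ℂ) (K' : Matrix A A ℂ) (hK : Kᴴ * K + K'ᴴ * K' = 1)
    (Q : Matrix (Fin 2) B ℂ) (Q' : Matrix B B ℂ) (hQ : Qᴴ * Q + Q'ᴴ * Q' = 1)
    {L : Matrix (R × S) (R × S) ℂ → Matrix (Fin 2 × Fin 2) (Fin 2 × Fin 2) ℂ}
    (hL : IsLOCC (Fin 2) (Fin 2) R S L) {ρ : Matrix (A × B) (A × B) ℂ} (hρ : ρ.trace = 1)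
    {τ : Matrix (R × S) (R × S) ℂ} (hτ : τ.trace = 1) :
    ∃ L', IsLOCC (Fin 2) (Fin 2) (A × R) (B × S) L' ∧
      L' (bipartiteProd ρ τ) = localConj K Q ρ + (1 - (localConj K Q ρ).trace) • L τ := by
  obtain ⟨M, hM, hM'⟩ := IsLOCC.discard_right (R := R) (S := S)
    (IsLOCC.done (A' := Fin 2) (B' := Fin 2))
  obtain ⟨M', hM₁, hM₁'⟩ := IsLOCC.discard_left (A := Fin 2) (B := Fin 2) hL
  have key : ∀ {T U : Type} [Fintype T] [DecidableEq T] [Fintype U] [DecidableEq U]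
      (K : Matrix (Fin 2) T ℂ) (K' : Matrix T T ℂ), Kᴴ * K + K'ᴴ * K' = 1 →
      ∑ i, (filterKraus K K' i ⊗ₖ (1 : Matrix U U ℂ))ᴴ *
        (filterKraus K K' i ⊗ₖ (1 : Matrix U U ℂ)) = 1 := by
    intro T U _ _ _ _ K K' h
    rw [← Matrix.one_kronecker_one, ← h, ← sum_filterKraus]
    simp only [Matrix.conjTranspose_kronecker, ← Matrix.mul_kronecker_mul,
      Matrix.conjTranspose_one, Matrix.one_mul]
    ext x y
    simp [Matrix.sum_apply, Finset.sum_mul, add_mul]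
  -- If both filters succeed, the filtered pair is kept and `τ` is discarded. Otherwise the reset
  -- pair is discarded and `L` runs on the untouched `τ`; by `hsum` these branches have total weight
  -- `1 - tr (localConj K Q ρ)`.
  refine ⟨_, IsLOCC.localMeasure _ (key (U := R) K K' hK) _ (key (U := S) Q Q' hQ)
    (fun i j => if i = none ∧ j = none then M else M') (fun i j => by split_ifs <;> assumption), ?_⟩
  have hsum := sum_trace_localConj _ ((sum_filterKraus K K').trans hK) _
    ((sum_filterKraus Q Q').trans hQ) ρ
  have one : ∀ τ : Matrix (R × S) (R × S) ℂ, localConj (1 : Matrix R R ℂ) (1 : Matrix S S ℂ) τ = τ := by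
    intro τ; simp [localConj]
  simp only [localConj_bipartiteProd, one]
  simp only [Fintype.sum_option, hρ] at hsum ⊢
  simp only [and_true, and_false, if_true, reduceCtorEq, if_false, and_self, hM', hM₁', hτ, one_smul]
  simp only [← Finset.sum_smul, ← add_smul, add_assoc]
  congr 2
  simp only [filterKraus] at hsum ⊢
  linear_combination hsum

/-! ### Distillation by repeated filtering -/

open scoped MatrixOrder Matrix.Norms.L2Operator in
/-- A sufficiently small multiple of a matrix is part of a measurement with two outcomes. -/
theorem exists_bound_forall_completion {A : Type} [Fintype A] [DecidableEq A]
    (K : Matrix (Fin 2) A ℂ) :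
    ∃ c : ℝ, ∀ r : ℝ, r ^ 2 * c ≤ 1 →
      ∃ R : Matrix A A ℂ, ((r : ℂ) • K)ᴴ * ((r : ℂ) • K) + Rᴴ * R = 1 := by
  refine ⟨‖Kᴴ * K‖, fun r hr => ?_⟩
  have hK := (Matrix.posSemidef_conjTranspose_mul_self K)
  have h1 : Kᴴ * K ≤ algebraMap ℝ (Matrix A A ℂ) ‖Kᴴ * K‖ :=
    IsSelfAdjoint.le_algebraMap_norm_self hK.isHermitian
  have h2 : (1 - ((r : ℂ) • K)ᴴ * ((r : ℂ) • K)).PosSemidef := by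
    rw [← Matrix.le_iff]
    have e : ((r : ℂ) • K)ᴴ * ((r : ℂ) • K) = (r ^ 2) • (Kᴴ * K) := by
      ext x y
      simp [Matrix.mul_apply]
      ring
    rw [e]
    refine (smul_le_smul_of_nonneg_left h1 (sq_nonneg r)).trans ?_
    rw [Matrix.le_iff, Algebra.algebraMap_eq_smul_one, smul_smul]
    have e' : (1 : Matrix A A ℂ) - (r ^ 2 * ‖Kᴴ * K‖) • 1 = (1 - r ^ 2 * ‖Kᴴ * K‖) • 1 := by
      rw [sub_smul, one_smul]
    rw [e']
    exact Matrix.PosSemidef.one.smul (sub_nonneg.mpr hr)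
  obtain ⟨Y, hY⟩ := h2.exists_eq_conjTranspose_mul_self
  exact ⟨Y, by rw [← hY]; abel⟩

/-- Filtering succeeds in one of `N` attempts, unless all of them fail. -/
theorem exists_isLOCC_repeat_filter {A B : Type} [Fintype A] [DecidableEq A] [Fintype B]
    [DecidableEq B] (K : Matrix (Fin 2) A ℂ) (K' : Matrix A A ℂ) (hK : Kᴴ * K + K'ᴴ * K' = 1)
    (Q : Matrix (Fin 2) B ℂ) (Q' : Matrix B B ℂ) (hQ : Qᴴ * Q + Q'ᴴ * Q' = 1)
    {ρ : Matrix (A × B) (A × B) ℂ} (hρ : ρ.trace = 1) {q f : ℝ}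
    (hq : (localConj K Q ρ).trace = q) (hq1 : q ≤ 1)
    (hf : f * q ≤ bellFidelity (localConj K Q ρ)) (N : ℕ) :
    ∃ L, IsLOCC (Fin 2) (Fin 2) (Fin N → A) (Fin N → B) L ∧
      f * (1 - (1 - q) ^ N) ≤ bellFidelity (L (bipartitePow (Fin N) ρ)) := by
  induction N with
  | zero =>
    -- With no copies left each system is one-dimensional, and mapping it isometrically to `|0⟩`
    -- suffices because the bound to be met is `0`.
    have h : ∀ {S : Type} [Fintype S] [DecidableEq S],
        (Matrix.of fun s _ => if s = 0 then 1 else 0 : Matrix (Fin 2) (Fin 0 → S) ℂ)ᴴ *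
          (Matrix.of fun s _ => if s = 0 then 1 else 0 : Matrix (Fin 2) (Fin 0 → S) ℂ) = 1 := by
      intro S _ _
      ext x y
      simp [Matrix.mul_apply, Matrix.one_apply, Subsingleton.elim x y]
    refine ⟨_, IsLOCC.comp_isometry _ h _ h IsLOCC.done, ?_⟩
    simp only [pow_zero, sub_self, mul_zero]
    refine bellFidelity_nonneg (Matrix.PosSemidef.localConj ?_ _ _)
    have e : bipartitePow (Fin 0) ρ = 1 := by
      ext x y
      simp [bipartitePow_apply, Matrix.one_apply, Subsingleton.elim x y]
    rw [e]
    exact Matrix.PosSemidef.one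
  | succ N ih =>
    obtain ⟨L, hL, hLf⟩ := ih
    obtain ⟨L', hL', e⟩ := IsLOCC.exists_filter_or_else K K' hK Q Q' hQ hL hρ
      (τ := bipartitePow (Fin N) ρ) (by rw [trace_bipartitePow, hρ, one_pow])
    refine ⟨_, hL'.comp_submatrix (Fin.consEquiv fun _ => A) (Fin.consEquiv fun _ => B), ?_⟩
    rw [bipartitePow_fin_succ, Matrix.submatrix_submatrix]
    have hid : Prod.map (fun f : Fin (N + 1) → A => (f 0, Fin.tail f))
        (fun f : Fin (N + 1) → B => (f 0, Fin.tail f)) ∘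
        Prod.map (Fin.consEquiv fun _ => A) (Fin.consEquiv fun _ => B) = id := by
      funext x
      simp [Fin.consEquiv, Prod.map]
    rw [hid, Matrix.submatrix_id_id, e, hq]
    have h2 : bellFidelity (localConj K Q ρ + (1 - (q : ℂ)) • L (bipartitePow (Fin N) ρ)) =
        bellFidelity (localConj K Q ρ) + (1 - q) * bellFidelity (L (bipartitePow (Fin N) ρ)) := by
      rw [← bellFidelity_smul]
      simp only [bellFidelity_eq, Matrix.add_apply, Complex.add_re, Complex.ofReal_sub,
        Complex.ofReal_one]
      ring
    rw [h2, pow_succ]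
    nlinarith [mul_le_mul_of_nonneg_left hLf (sub_nonneg.mpr hq1)]

/-- `Y` is obtained from finitely many copies of `X` by a successful local filter. -/
def FiltersTo {A B A₁ B₁ : Type} [Fintype A] [Fintype B] (X : Matrix (A × B) (A × B) ℂ)
    (Y : Matrix (A₁ × B₁) (A₁ × B₁) ℂ) : Prop :=
  ∃ (n : ℕ) (K : Matrix A₁ (Fin n → A) ℂ) (Q : Matrix B₁ (Fin n → B) ℂ),
    Y = localConj K Q (bipartitePow (Fin n) X)

section FiltersTo

variable {A B A₁ B₁ A₂ B₂ : Type} [Fintype A] [DecidableEq A] [Fintype B] [DecidableEq B]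

/-- Copies may be labelled by any finite type, so that blocks of blocks or pairs of copies need no
index arithmetic. -/
theorem FiltersTo.of_index {ι : Type} [Fintype ι] [DecidableEq ι] (X : Matrix (A × B) (A × B) ℂ)
    (K : Matrix A₁ (ι → A) ℂ) (Q : Matrix B₁ (ι → B) ℂ) :
    FiltersTo X (localConj K Q (bipartitePow ι X)) := by
  let e := (Fintype.equivFin ι).symm
  refine ⟨Fintype.card ι, K * (1 : Matrix (Fin _ → A) (Fin _ → A) ℂ).submatrix (fun f => f ∘ e) id,
    Q * (1 : Matrix (Fin _ → B) (Fin _ → B) ℂ).submatrix (fun f => f ∘ e) id, ?_⟩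
  rw [← localConj_localConj, localConj_one_submatrix, ← bipartitePow_reindex]

theorem FiltersTo.trans [Fintype A₁] [Fintype B₁] {X : Matrix (A × B) (A × B) ℂ}
    {Y : Matrix (A₁ × B₁) (A₁ × B₁) ℂ} {Z : Matrix (A₂ × B₂) (A₂ × B₂) ℂ}
    (hXY : FiltersTo X Y) (hYZ : FiltersTo Y Z) : FiltersTo X Z := by
  obtain ⟨n, K, Q, rfl⟩ := hXY
  obtain ⟨m, K', Q', rfl⟩ := hYZ
  rw [bipartitePow_localConj, bipartitePow_bipartitePow, ← localConj_one_submatrix,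
    localConj_localConj, localConj_localConj]
  exact FiltersTo.of_index _ _ _

theorem FiltersTo.posSemidef [Fintype A₁] [Fintype B₁] {X : Matrix (A × B) (A × B) ℂ}
    {Y : Matrix (A₁ × B₁) (A₁ × B₁) ℂ} (h : FiltersTo X Y) (hX : X.PosSemidef) :
    Y.PosSemidef := by
  obtain ⟨n, K, Q, rfl⟩ := h
  exact hX.bipartitePow.localConj _ _

end FiltersTo

theorem Matrix.PosSemidef.trace_eq_ofReal_re {S : Type} [Fintype S] {M : Matrix S S ℂ}
    (hM : M.PosSemidef) : M.trace = (M.trace.re : ℂ) :=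
  Complex.eq_re_of_ofReal_le hM.trace_nonneg

/-- A state is distillable if filtering can produce arbitrarily good fidelities. -/
theorem isDistillable_of_filtersTo {A B : Type} [Fintype A] [DecidableEq A] [Fintype B]
    [DecidableEq B] {ρ : Matrix (A × B) (A × B) ℂ} (hρ : IsDensity ρ)
    (h : ∀ ε : ℝ, 0 < ε → ∃ σ : Matrix (Fin 2 × Fin 2) (Fin 2 × Fin 2) ℂ,
      FiltersTo ρ σ ∧ 0 < σ.trace.re ∧ (1 - ε) * σ.trace.re ≤ bellFidelity σ) :
    IsDistillable ρ := by
  intro ε hε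
  obtain ⟨_, ⟨n, K, Q, rfl⟩, hpos, hF⟩ := h (min (ε / 2) 1) (by positivity)
  have hε1 : min (ε / 2) 1 ≤ 1 := min_le_right _ _
  have hε2 : min (ε / 2) 1 ≤ ε / 2 := min_le_left _ _
  set δ := min (ε / 2) 1
  have hψ : (bipartitePow (Fin n) ρ).PosSemidef := hρ.1.bipartitePow
  have htr : (bipartitePow (Fin n) ρ).trace = 1 := by rw [trace_bipartitePow, hρ.2, one_pow]
  have hσ := (hψ.localConj K Q).trace_eq_ofReal_re
  set t := (localConj K Q (bipartitePow (Fin n) ρ)).trace.re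
  obtain ⟨c, hc⟩ := exists_bound_forall_completion K
  obtain ⟨c', hc'⟩ := exists_bound_forall_completion Q
  -- Both filters are multiplied by `r`, so the success probability becomes `r ^ 4 * t`. All the
  -- constraints hold for small positive `r`.
  obtain ⟨r, hr0, hrc, hrc', hrt⟩ : ∃ r : ℝ, 0 < r ∧ r ^ 2 * c ≤ 1 ∧ r ^ 2 * c' ≤ 1 ∧
      r ^ 4 * t ≤ 1 := by
    have key : ∀ (k : ℕ) (x : ℝ), k ≠ 0 → ∀ᶠ r : ℝ in nhdsWithin 0 (Set.Ioi 0), r ^ k * x ≤ 1 := by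
      intro k x hk
      have hcont : Filter.Tendsto (fun r : ℝ => r ^ k * x) (nhds 0) (nhds (0 ^ k * x)) :=
        Continuous.tendsto (by fun_prop) 0
      rw [zero_pow hk, zero_mul] at hcont
      exact (hcont.mono_left nhdsWithin_le_nhds).eventually (ge_mem_nhds one_pos)
    obtain ⟨r, ⟨⟨h1, h2⟩, h3⟩, h4⟩ := (((key 2 c two_ne_zero).and (key 2 c' two_ne_zero)).and
      (key 4 t four_ne_zero)).and self_mem_nhdsWithin |>.exists
    exact ⟨r, h4, h1, h2, h3⟩
  obtain ⟨R, hR⟩ := hc r hrc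
  obtain ⟨R', hR'⟩ := hc' r hrc'
  have hq0 : 0 < r ^ 4 * t := by positivity
  -- All `N` attempts fail with probability below `ε / 2`. Together with the loss `δ ≤ ε / 2` in
  -- each success this costs at most `ε`.
  obtain ⟨N, hN⟩ := exists_pow_lt_of_lt_one (half_pos hε) (sub_lt_self 1 hq0)
  obtain ⟨L, hL, hLF⟩ := exists_isLOCC_repeat_filter _ R hR _ R' hR' htr (q := r ^ 4 * t)
    (f := 1 - δ) (by
      rw [localConj_smul_smul, Matrix.trace_smul, hσ, smul_eq_mul, ← Complex.ofReal_mul]) hrt (by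
      rw [localConj_smul_smul, bellFidelity_smul]
      nlinarith [pow_pos hr0 4]) N
  have hsub := bipartitePow_bipartitePow (ι := Fin N) (κ := Fin n) ρ
  rw [bipartitePow_reindex (finProdFinEquiv.symm : Fin (N * n) ≃ Fin N × Fin n) ρ,
    Matrix.submatrix_submatrix] at hsub
  refine ⟨N * n, _, hL.comp_submatrix
    ((Equiv.curry (Fin N) (Fin n) A).symm.trans (finProdFinEquiv.arrowCongr (Equiv.refl A)))
    ((Equiv.curry (Fin N) (Fin n) B).symm.trans (finProdFinEquiv.arrowCongr (Equiv.refl B))), ?_⟩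
  refine le_trans ?_ (hLF.trans_eq (congrArg (fun Y => bellFidelity (L Y)) hsub))
  have : 0 ≤ (1 - r ^ 4 * t) ^ N := pow_nonneg (sub_nonneg.mpr hrt) N
  have hδ : 0 ≤ δ := le_min (half_pos hε).le zero_le_one
  nlinarith [mul_nonneg hδ this]

/-! ### Distilling two-qubit states -/

/-- These are the lengths of the two recurrence steps. The coherence `p ^ n` may become tiny, but `q
^ n` is smaller by any desired factor. Hence `m` of order `log (1 / δ) / p ^ n` is large enough to
remove phase errors while the accumulated bit errors `m * q ^ n` stay small. -/
theorem exists_pow_recurrence {p q δ : ℝ} (hp : p ≤ 1) (hq : 0 ≤ q) (hqp : q < p)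
    (hδ : 0 < δ) :
    ∃ n m : ℕ, 4 * q ^ n ≤ p ^ n ∧ 8 * (m * q ^ n) ≤ δ ∧ Real.exp (-(m * p ^ n)) ≤ δ := by
  have hp0 : 0 < p := hq.trans_lt hqp
  set l := max 0 (-Real.log δ)
  have hl : 0 ≤ l := le_max_left _ _
  obtain ⟨n, hn⟩ := exists_pow_lt_of_lt_one (y := q / p) (x := min (1 / 4) (δ / (8 * (l + 1))))
    (by positivity) ((div_lt_one hp0).mpr hqp)
  have h1 := hn.le.trans (min_le_left _ _)
  have h2 := hn.le.trans (min_le_right _ _)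
  have hpn : 0 < p ^ n := pow_pos hp0 n
  rw [div_pow, div_le_iff₀ hpn] at h1 h2
  refine ⟨n, ⌈l / p ^ n⌉₊, by linarith, ?_, ?_⟩
  -- Rounding up costs at most `p ^ n ≤ 1`; this is the `l + 1` in the choice of `n`.
  · have h3 : (⌈l / p ^ n⌉₊ : ℝ) * p ^ n ≤ l + 1 := by
      have h4 := (Nat.ceil_lt_add_one (div_nonneg hl hpn.le)).le
      have h5 : p ^ n ≤ 1 := pow_le_one₀ hp0.le hp
      calc _ ≤ (l / p ^ n + 1) * p ^ n := mul_le_mul_of_nonneg_right h4 hpn.le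
        _ = l + p ^ n := by field_simp
        _ ≤ l + 1 := by linarith
    have h6 := mul_le_mul_of_nonneg_left h2 (Nat.cast_nonneg (α := ℝ) ⌈l / p ^ n⌉₊)
    have h7 := mul_le_mul_of_nonneg_left h3 (div_nonneg hδ.le (by positivity : 0 ≤ 8 * (l + 1)))
    have h8 : δ / (8 * (l + 1)) * (l + 1) = δ / 8 := by field_simp
    linarith
  · have h3 : l ≤ ⌈l / p ^ n⌉₊ * p ^ n := (div_le_iff₀ hpn).mp (Nat.le_ceil _)
    rw [← Real.le_log_iff_exp_le hδ]
    linarith [le_max_right 0 (-Real.log δ)]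

/-- After the first step, in units of the weight on `|00⟩, |11⟩`, the coherence there is `h`, the
weight on `|01⟩, |10⟩` is `g`, and its coherence is `t`. The second step turns `x, y, z` into `m`-th
powers. Bernoulli's inequality gives `y ^ m / x ^ m ≥ (1 - 4 * g) ^ (2 * m) ≥ 1 - δ`, and `(1 - h /
2) ^ 2 ≤ exp (-h)` gives `z ^ m / y ^ m ≤ exp (-(m * h)) ≤ δ`. -/
theorem recurrence_bound {g h t x y z δ ε : ℝ} {m : ℕ} (ht : 0 ≤ t) (htg : t ≤ g) (hh : h ≤ 1)
    (hgh : 4 * g ≤ h) (hg : 8 * (m * g) ≤ δ) (hexp : Real.exp (-(m * h)) ≤ δ)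
    (hδε : δ ≤ ε / 2) (hδ : δ ≤ 1 / 2) (hz : 0 ≤ z) (hyx : y ≤ x)
    (hx : x ≤ (1 + h + g + t) ^ 2) (hy : (1 + h - g - t) ^ 2 ≤ y)
    (hzW : z ≤ (1 - h + g - t) ^ 2) :
    0 < 2 * x ^ m + 2 * z ^ m ∧ (1 - ε) * (2 * x ^ m + 2 * z ^ m) ≤ x ^ m + y ^ m := by
  have hg0 : 0 ≤ g := ht.trans htg
  have hD : 0 < 1 + h - g - t := by linarith
  have hy0 : 0 < y := (pow_pos hD 2).trans_le hy
  have hx0 : 0 < x := hy0.trans_le hyx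
  have hY : 0 < y ^ m := pow_pos hy0 m
  have hX : 0 < x ^ m := pow_pos hx0 m
  have hZ : 0 ≤ z ^ m := pow_nonneg hz m
  have hDm : ((1 + h - g - t) ^ 2) ^ m ≤ y ^ m := pow_le_pow_left₀ (sq_nonneg _) hy m
  have h1 : (1 - δ) * x ^ m ≤ y ^ m := by
    have hb : 1 + ((2 * m : ℕ) : ℝ) * (-(4 * g)) ≤ (1 + -(4 * g)) ^ (2 * m) :=
      one_add_mul_le_pow (by linarith) _
    have hSD : (1 - 4 * g) * (1 + h + g + t) ≤ 1 + h - g - t := by nlinarith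
    calc (1 - δ) * x ^ m ≤ (1 - 4 * g) ^ (2 * m) * ((1 + h + g + t) ^ 2) ^ m := by
          refine mul_le_mul ?_ (pow_le_pow_left₀ hx0.le hx m) hX.le
            (pow_nonneg (by linarith) _)
          rw [← sub_eq_add_neg] at hb
          push_cast at hb
          linarith
      _ = (((1 - 4 * g) * (1 + h + g + t)) ^ 2) ^ m := by
          rw [pow_mul, ← mul_pow, ← mul_pow]
      _ ≤ ((1 + h - g - t) ^ 2) ^ m := by
          refine pow_le_pow_left₀ (sq_nonneg _) (pow_le_pow_left₀ ?_ hSD 2) m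
          exact mul_nonneg (by linarith) (by linarith)
      _ ≤ y ^ m := hDm
  have h2 : z ^ m ≤ δ * y ^ m := by
    have hWD : 1 - h + g - t ≤ (1 - h / 2) * (1 + h - g - t) := by nlinarith
    have he : (1 - h / 2) ^ 2 ≤ Real.exp (-h) := by
      have := pow_le_pow_left₀ (by linarith) (Real.add_one_le_exp (-(h / 2))) 2
      rw [← Real.exp_nat_mul] at this
      rw [show ((2 : ℕ) : ℝ) * -(h / 2) = -h by push_cast; ring] at this
      rwa [show 1 - h / 2 = -(h / 2) + 1 by ring]
    calc z ^ m ≤ (((1 - h / 2) * (1 + h - g - t)) ^ 2) ^ m :=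
          pow_le_pow_left₀ hz (hzW.trans (pow_le_pow_left₀ (by linarith) hWD 2)) m
      _ = ((1 - h / 2) ^ 2) ^ m * ((1 + h - g - t) ^ 2) ^ m := by rw [mul_pow, mul_pow]
      _ ≤ Real.exp (-h) ^ m * y ^ m :=
          mul_le_mul (pow_le_pow_left₀ (sq_nonneg _) he m) hDm (by positivity) (by positivity)
      _ ≤ δ * y ^ m := by
          refine mul_le_mul_of_nonneg_right ?_ hY.le
          rw [← Real.exp_nat_mul, mul_neg]
          exact hexp
  refine ⟨by positivity, ?_⟩
  have hδ0 : 0 < δ := (Real.exp_pos _).trans_le hexp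
  rcases le_total 1 ε with hε | hε
  · exact (mul_nonpos_of_nonpos_of_nonneg (by linarith) (by positivity)).trans (by positivity)
  · have h3 : (1 - ε) * z ^ m ≤ δ * y ^ m := by nlinarith
    have h4 : (1 - 2 * δ) * ((1 - δ) * x ^ m) ≤ (1 - 2 * δ) * y ^ m :=
      mul_le_mul_of_nonneg_left h1 (by linarith)
    nlinarith [mul_pos hX hδ0, mul_pos (mul_pos hX hδ0) hδ0,
      mul_nonneg hX.le (by linarith : 0 ≤ ε - 2 * δ)]

/-- The result of a recurrence step on `2 n` copies of a two-qubit state, half of which are flipped: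
both parties keep the states `|s⟩ ⊗ ⋯ ⊗ |s⟩`. -/
def symPow (n : ℕ) (σ : Matrix (Fin 2 × Fin 2) (Fin 2 × Fin 2) ℂ) :
    Matrix (Fin 2 × Fin 2) (Fin 2 × Fin 2) ℂ :=
  Matrix.of fun x y => (σ x y * σ (x + 1) (y + 1)) ^ n

/-- The flip of half of the copies is built into the strings that are kept: logical `s` is the
string with entry `s` on unflipped and `s + 1` on flipped copies. -/
theorem filtersTo_symPow (n : ℕ) (σ : Matrix (Fin 2 × Fin 2) (Fin 2 × Fin 2) ℂ) :
    FiltersTo σ (symPow n σ) := by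
  have h := FiltersTo.of_index (ι := Fin n × Fin 2) σ
    ((1 : Matrix (Fin n × Fin 2 → Fin 2) (Fin n × Fin 2 → Fin 2) ℂ).submatrix
      (fun s k => s + k.2) id)
    ((1 : Matrix (Fin n × Fin 2 → Fin 2) (Fin n × Fin 2 → Fin 2) ℂ).submatrix
      (fun s k => s + k.2) id)
  rw [localConj_one_submatrix] at h
  convert h using 1
  ext x y
  simp only [symPow, Matrix.of_apply, Matrix.submatrix_apply, bipartitePow_apply, Prod.map_fst,
    Prod.map_snd, Fintype.prod_prod_type, Fin.prod_univ_two, Finset.prod_const, Finset.card_univ,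
    Fintype.card_fin, add_zero]
  rfl

theorem filtersTo_localConj {A B A₁ B₁ : Type} [Fintype A] [DecidableEq A] [Fintype B]
    [DecidableEq B] (K : Matrix A₁ A ℂ) (Q : Matrix B₁ B ℂ) (X : Matrix (A × B) (A × B) ℂ) :
    FiltersTo X (localConj K Q X) := by
  have h := FiltersTo.of_index (ι := Unit) X
    (K * (1 : Matrix (Unit → A) (Unit → A) ℂ).submatrix (fun a _ => a) id)
    (Q * (1 : Matrix (Unit → B) (Unit → B) ℂ).submatrix (fun a _ => a) id)
  rw [← localConj_localConj, localConj_one_submatrix] at h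
  convert h
  ext x y
  simp [bipartitePow_apply]

-- Entries of positive semidefinite matrices.

namespace Matrix.PosSemidef

variable {S : Type} {M : Matrix S S ℂ}

theorem diag_eq_ofReal_re (hM : M.PosSemidef) (i : S) : M i i = ((M i i).re : ℂ) :=
  Complex.eq_re_of_ofReal_le hM.diag_nonneg

theorem diag_re_nonneg (hM : M.PosSemidef) (i : S) : 0 ≤ (M i i).re :=
  (Complex.le_def.mp hM.diag_nonneg).1

theorem normSq_le [Fintype S] (hM : M.PosSemidef) (i j : S) :
    Complex.normSq (M i j) ≤ (M i i).re * (M j j).re := by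
  have h := (hM.submatrix ![i, j]).det_nonneg
  rw [Matrix.det_fin_two] at h
  simp only [Matrix.submatrix_apply, Matrix.cons_val_zero, Matrix.cons_val_one] at h
  rw [← hM.isHermitian.apply j i, hM.diag_eq_ofReal_re i, hM.diag_eq_ofReal_re j,
    show M i j * star (M i j) = _ from Complex.mul_conj _, ← Complex.ofReal_mul,
    ← Complex.ofReal_sub] at h
  exact sub_nonneg.mp (Complex.zero_le_real.mp h)

end Matrix.PosSemidef

-- The recurrence steps for two-qubit states.

section twoQubit

variable {σ : Matrix (Fin 2 × Fin 2) (Fin 2 × Fin 2) ℂ}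

theorem symPow_apply_diag (hσ : σ.PosSemidef) (n : ℕ) (x : Fin 2 × Fin 2) :
    symPow n σ x x = ((((σ x x).re * (σ (x + 1) (x + 1)).re) ^ n : ℝ) : ℂ) := by
  rw [symPow, Matrix.of_apply, hσ.diag_eq_ofReal_re x, hσ.diag_eq_ofReal_re (x + 1)]
  push_cast
  simp

theorem symPow_apply_flip (hσ : σ.PosSemidef) (n : ℕ) (x : Fin 2 × Fin 2) :
    symPow n σ x (x + 1) = ((Complex.normSq (σ x (x + 1)) ^ n : ℝ) : ℂ) := by
  have h : x + 1 + 1 = x := by revert x; decide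
  rw [symPow, Matrix.of_apply, h, ← hσ.isHermitian.apply (x + 1) x,
    show σ x (x + 1) * star (σ x (x + 1)) = _ from Complex.mul_conj _]
  push_cast
  rfl

theorem symPow_add_one (n : ℕ) (x y : Fin 2 × Fin 2) :
    symPow n σ (x + 1) (y + 1) = symPow n σ x y := by
  have h : ∀ x : Fin 2 × Fin 2, x + 1 + 1 = x := by decide
  rw [symPow, Matrix.of_apply, Matrix.of_apply, h, h, mul_comm]

theorem bellFidelity_symPow (hσ : σ.PosSemidef) (n : ℕ) :
    bellFidelity (symPow n σ) = ((σ (0, 0) (0, 0)).re * (σ (1, 1) (1, 1)).re) ^ n +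
      Complex.normSq (σ (0, 0) (1, 1)) ^ n := by
  have h1 := symPow_apply_diag hσ n (0, 0)
  have h2 := symPow_apply_flip hσ n (0, 0)
  have h3 := symPow_add_one (σ := σ) n (0, 0) (0, 0)
  have h4 := symPow_add_one (σ := σ) n (0, 0) (1, 1)
  have e1 : ((0, 0) : Fin 2 × Fin 2) + 1 = (1, 1) := rfl
  have e2 : ((1, 1) : Fin 2 × Fin 2) + 1 = (0, 0) := rfl
  rw [e1] at h1 h2 h3 h4
  rw [e2] at h4
  rw [bellFidelity_eq, h3, h4, h1, h2, Complex.ofReal_re, Complex.ofReal_re]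
  ring

theorem trace_symPow (hσ : σ.PosSemidef) (n : ℕ) :
    (symPow n σ).trace.re = 2 * ((σ (0, 0) (0, 0)).re * (σ (1, 1) (1, 1)).re) ^ n +
      2 * ((σ (0, 1) (0, 1)).re * (σ (1, 0) (1, 0)).re) ^ n := by
  have h1 := symPow_apply_diag hσ n (0, 0)
  have h2 := symPow_apply_diag hσ n (0, 1)
  have h3 := symPow_add_one (σ := σ) n (0, 0) (0, 0)
  have h4 := symPow_add_one (σ := σ) n (0, 1) (0, 1)
  have e1 : ((0, 0) : Fin 2 × Fin 2) + 1 = (1, 1) := rfl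
  have e2 : ((0, 1) : Fin 2 × Fin 2) + 1 = (1, 0) := rfl
  rw [e1] at h1 h3
  rw [e2] at h2 h4
  rw [Matrix.trace]
  simp only [Matrix.diag_apply, Fintype.sum_prod_type, Fin.sum_univ_two]
  rw [h3, h4, h1, h2]
  simp only [Complex.add_re, Complex.ofReal_re]
  ring

/-- The Hadamard rotation exchanges phase and bit errors; it is left unnormalized, whence the
factors `4`. The uncontrolled coherences `u`, `v` enter the two diagonal entries of each product
with opposite signs, so they can only decrease it: `(P + r) * (P - r) ≤ P ^ 2`. -/
theorem localConj_hadamard_bounds (hσ : σ.PosSemidef) (h1 : ∀ x y, σ (x + 1) (y + 1) = σ x y)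
    {α β γ η : ℝ} (hα : σ (0, 0) (0, 0) = α) (hβ : σ (0, 0) (1, 1) = β)
    (hγ : σ (0, 1) (0, 1) = γ) (hη : σ (0, 1) (1, 0) = η) :
    let τ := localConj !![1, 1; 1, -1] !![1, 1; 1, -1] σ
    (τ (0, 0) (0, 0)).re * (τ (1, 1) (1, 1)).re ≤ 4 * (α + β + γ + η) ^ 2 ∧
      4 * (α + β - γ - η) ^ 2 ≤ Complex.normSq (τ (0, 0) (1, 1)) ∧
      (τ (0, 1) (0, 1)).re * (τ (1, 0) (1, 0)).re ≤ 4 * (α - β + γ - η) ^ 2 := by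
  have f1 : σ (1, 1) (1, 1) = α := (h1 (0, 0) (0, 0)).trans hα
  have f2 : σ (1, 1) (0, 0) = β := (h1 (0, 0) (1, 1)).trans hβ
  have f3 : σ (1, 0) (1, 0) = γ := (h1 (0, 1) (0, 1)).trans hγ
  have f4 : σ (1, 0) (0, 1) = η := (h1 (0, 1) (1, 0)).trans hη
  have f5 : σ (1, 1) (1, 0) = σ (0, 0) (0, 1) := h1 (0, 0) (0, 1)
  have f6 : σ (1, 1) (0, 1) = σ (0, 0) (1, 0) := h1 (0, 0) (1, 0)
  have f7 : σ (0, 1) (0, 0) = star (σ (0, 0) (0, 1)) := (hσ.isHermitian.apply _ _).symm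
  have f8 : σ (1, 0) (0, 0) = star (σ (0, 0) (1, 0)) := (hσ.isHermitian.apply _ _).symm
  have f9 : σ (1, 0) (1, 1) = star (σ (0, 0) (0, 1)) := (h1 (0, 1) (0, 0)).trans f7
  have f10 : σ (0, 1) (1, 1) = star (σ (0, 0) (1, 0)) := (h1 (1, 0) (0, 0)).trans f8
  have g1 : ∀ x y : Fin 2 × Fin 2, localConj !![1, 1; 1, -1] !![1, 1; 1, -1] σ x y = _ :=
    fun x y => localConj_apply _ _ _ _ _
  intro τ
  set u := σ (0, 0) (0, 1)
  set v := σ (0, 0) (1, 0)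
  have k1 : (τ (0, 0) (0, 0)).re = 2 * (α + β + γ + η) + 4 * (u.re + v.re) := by
    simp [τ, g1, hα, hβ, hγ, hη, f1, f2, f3, f4, f5, f6, f7, f8, f9, f10]
    ring
  have k2 : (τ (1, 1) (1, 1)).re = 2 * (α + β + γ + η) - 4 * (u.re + v.re) := by
    simp [τ, g1, hα, hβ, hγ, hη, f1, f2, f3, f4, f5, f6, f7, f8, f9, f10]
    ring
  have k3 : (τ (0, 1) (0, 1)).re = 2 * (α - β + γ - η) + 4 * (v.re - u.re) := by
    simp [τ, g1, hα, hβ, hγ, hη, f1, f2, f3, f4, f5, f6, f7, f8, f9, f10]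
    ring
  have k4 : (τ (1, 0) (1, 0)).re = 2 * (α - β + γ - η) - 4 * (v.re - u.re) := by
    simp [τ, g1, hα, hβ, hγ, hη, f1, f2, f3, f4, f5, f6, f7, f8, f9, f10]
    ring
  have k5 : (τ (0, 0) (1, 1)).re = 2 * (α + β - γ - η) := by
    simp [τ, g1, hα, hβ, hγ, hη, f1, f2, f3, f4, f5, f6, f7, f8, f9, f10]
    ring
  rw [Complex.normSq_apply, k1, k2, k3, k4, k5]
  refine ⟨?_, ?_, ?_⟩
  · nlinarith [sq_nonneg (u.re + v.re)]
  · nlinarith [mul_self_nonneg (τ (0, 0) (1, 1)).im]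
  · nlinarith [sq_nonneg (v.re - u.re)]

/-- Two-qubit states with a fidelity above one half can be purified by filtering. -/
theorem exists_filtersTo_of_fidelity (hσ : σ.PosSemidef)
    (h : (σ (0, 1) (0, 1)).re + (σ (1, 0) (1, 0)).re <
      (σ (0, 0) (1, 1)).re + (σ (1, 1) (0, 0)).re) {ε : ℝ} (hε : 0 < ε) :
    ∃ τ : Matrix (Fin 2 × Fin 2) (Fin 2 × Fin 2) ℂ,
      FiltersTo σ τ ∧ 0 < τ.trace.re ∧ (1 - ε) * τ.trace.re ≤ bellFidelity τ := by
  have hba := hσ.normSq_le (0, 0) (1, 1)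
  have hec := hσ.normSq_le (0, 1) (1, 0)
  have hC := hσ.diag_re_nonneg (0, 1)
  have hC' := hσ.diag_re_nonneg (1, 0)
  -- By the inequality of arithmetic and geometric means, the product is at most the squared
  -- half-sum, which `h` puts below the squared real part of the coherence.
  have hcb : (σ (0, 1) (0, 1)).re * (σ (1, 0) (1, 0)).re <
      Complex.normSq (σ (0, 0) (1, 1)) := by
    have e : (σ (1, 1) (0, 0)).re = (σ (0, 0) (1, 1)).re := by
      rw [← hσ.isHermitian.apply]; rfl
    rw [e] at h
    rw [Complex.normSq_apply]
    nlinarith [sq_nonneg ((σ (0, 1) (0, 1)).re - (σ (1, 0) (1, 0)).re),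
      mul_self_nonneg (σ (0, 0) (1, 1)).im]
  have he := Complex.normSq_nonneg (σ (0, 1) (1, 0))
  have hc := mul_nonneg hC hC'
  set a := (σ (0, 0) (0, 0)).re * (σ (1, 1) (1, 1)).re with ha_def
  set b := Complex.normSq (σ (0, 0) (1, 1)) with hb_def
  set c := (σ (0, 1) (0, 1)).re * (σ (1, 0) (1, 0)).re with hc_def
  set e := Complex.normSq (σ (0, 1) (1, 0)) with he_def
  have hb : 0 < b := hc.trans_lt hcb
  have ha : 0 < a := hb.trans_le hba
  -- The first step raises the ratios `b / a` of coherence and `c / a` of bit errors to the power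
  -- `n`, so `c < b` is all that is needed.
  obtain ⟨n, m, hn1, hn2, hn3⟩ := exists_pow_recurrence (p := b / a) (q := c / a)
    (δ := min (ε / 2) (1 / 2)) ((div_le_one ha).mpr hba) (div_nonneg hc ha.le)
    (div_lt_div_of_pos_right hcb ha) (by positivity)
  have hτ := (filtersTo_symPow n σ).posSemidef hσ
  have hbd := localConj_hadamard_bounds hτ (symPow_add_one n) (symPow_apply_diag hσ n (0, 0))
    (symPow_apply_flip hσ n (0, 0)) (symPow_apply_diag hσ n (0, 1)) (symPow_apply_flip hσ n (0, 1))
  have hfilt := (filtersTo_symPow n σ).trans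
    (filtersTo_localConj !![1, 1; 1, -1] !![1, 1; 1, -1] _)
  have hpos := hfilt.posSemidef hσ
  set ω := localConj !![1, 1; 1, -1] !![1, 1; 1, -1] (symPow n σ)
  obtain ⟨b1, b2, b3⟩ := hbd
  change _ ≤ 4 * (a ^ n + b ^ n + c ^ n + e ^ n) ^ 2 at b1
  change 4 * (a ^ n + b ^ n - c ^ n - e ^ n) ^ 2 ≤ _ at b2
  change _ ≤ 4 * (a ^ n - b ^ n + c ^ n - e ^ n) ^ 2 at b3
  refine ⟨_, hfilt.trans (filtersTo_symPow m ω), ?_⟩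
  rw [trace_symPow hpos, bellFidelity_symPow hpos]
  have hyx := hpos.normSq_le (0, 0) (1, 1)
  have hz := mul_nonneg (hpos.diag_re_nonneg (0, 1)) (hpos.diag_re_nonneg (1, 0))
  set x := (ω (0, 0) (0, 0)).re * (ω (1, 1) (1, 1)).re
  set y := Complex.normSq (ω (0, 0) (1, 1))
  set z := (ω (0, 1) (0, 1)).re * (ω (1, 0) (1, 0)).re
  have hs : 0 < 4 * (a ^ n) ^ 2 := by positivity
  have key := recurrence_bound (t := (e / a) ^ n) (x := x / (4 * (a ^ n) ^ 2))
    (y := y / (4 * (a ^ n) ^ 2)) (z := z / (4 * (a ^ n) ^ 2)) (ε := ε)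
    (pow_nonneg (div_nonneg he ha.le) n)
    (pow_le_pow_left₀ (div_nonneg he ha.le) (div_le_div_of_nonneg_right hec ha.le) n)
    (pow_le_one₀ (div_nonneg hb.le ha.le) ((div_le_one ha).mpr hba)) hn1 hn2 hn3
    (min_le_left _ _) (min_le_right _ _) (div_nonneg hz hs.le)
    (div_le_div_of_nonneg_right hyx hs.le)
    (by
      rw [div_le_iff₀ hs]
      refine b1.trans_eq ?_
      simp only [div_pow]
      field_simp)
    (by
      rw [le_div_iff₀ hs]
      refine Eq.trans_le ?_ b2
      simp only [div_pow]
      field_simp)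
    (by
      rw [div_le_iff₀ hs]
      refine b3.trans_eq ?_
      simp only [div_pow]
      field_simp)
  have hsm := pow_pos hs m
  simp only [div_pow _ (4 * (a ^ n) ^ 2)] at key
  have r1 : 2 * (x ^ m / (4 * (a ^ n) ^ 2) ^ m) + 2 * (z ^ m / (4 * (a ^ n) ^ 2) ^ m) =
      (2 * x ^ m + 2 * z ^ m) / (4 * (a ^ n) ^ 2) ^ m := by ring
  rw [r1, ← add_div, ← mul_div_assoc] at key
  exact ⟨(div_pos_iff_of_pos_right hsm).mp key.1, (div_le_div_iff_of_pos_right hsm).mp key.2⟩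

end twoQubit

/-! ### Undistillable states satisfy the reduction criterion -/

/-- The quantity `tr σ - 2 ⟨Φ⁺|σ|Φ⁺⟩` of a two-qubit operator. -/
def fidelityDefect (σ : Matrix (Fin 2 × Fin 2) (Fin 2 × Fin 2) ℂ) : ℂ :=
  σ (0, 1) (0, 1) + σ (1, 0) (1, 0) - σ (0, 0) (1, 1) - σ (1, 1) (0, 0)

/-- A negative defect means a normalized fidelity above one half after filtering, which purification
would turn into distillability. -/
theorem fidelityDefect_localConj_nonneg {A B : Type} [Fintype A] [DecidableEq A] [Fintype B]
    [DecidableEq B] {ρ : Matrix (A × B) (A × B) ℂ} (hρ : IsDensity ρ) (h : ¬ IsDistillable ρ)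
    (K : Matrix (Fin 2) A ℂ) (Q : Matrix (Fin 2) B ℂ) :
    0 ≤ (fidelityDefect (localConj K Q ρ)).re := by
  by_contra hneg
  refine h (isDistillable_of_filtersTo hρ fun ε hε => ?_)
  simp only [fidelityDefect, Complex.sub_re, Complex.add_re, not_le] at hneg
  obtain ⟨τ, hτ, h'⟩ := exists_filtersTo_of_fidelity (hρ.1.localConj K Q) (by linarith) hε
  exact ⟨τ, (filtersTo_localConj K Q ρ).trans hτ, h'⟩

theorem fidelityDefect_sum {ι : Type*} (s : Finset ι)
    (σ : ι → Matrix (Fin 2 × Fin 2) (Fin 2 × Fin 2) ℂ) :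
    fidelityDefect (∑ i ∈ s, σ i) = ∑ i ∈ s, fidelityDefect (σ i) := by
  simp only [fidelityDefect, Matrix.sum_apply, Finset.sum_add_distrib, Finset.sum_sub_distrib]

/-- The Kraus decomposition of a quantum channel on the second half of a bipartite system. -/
theorem QuantumChannel.exists_kraus {B C : Type} [Fintype B] [DecidableEq B] [Fintype C]
    [DecidableEq C] (D : QuantumChannel B C) (A : Type) [Fintype A] [DecidableEq A] :
    ∃ (ι : Type) (_ : Fintype ι) (E : ι → Matrix C B ℂ), ∀ X : Matrix (A × B) (A × B) ℂ,
      idTensor A D.map X = ∑ k, localConj (1 : Matrix A A ℂ) (E k) X := by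
  let e := Fintype.equivFin B
  let Ω : Matrix (Fin (Fintype.card B) × B) (Fin (Fintype.card B) × B) ℂ :=
    Matrix.vecMulVec (fun x => if e.symm x.1 = x.2 then 1 else 0)
      (star fun x => if e.symm x.1 = x.2 then 1 else 0)
  -- `Ω` is an unnormalized maximally entangled state, with the reference labelled by `Fin` as in
  -- the definition of complete positivity. The conjugated rows of a factor `Y` of the Choi matrix
  -- are the Kraus operators.
  obtain ⟨Y, hY⟩ := (D.completelyPositive _ Ω
    (Matrix.posSemidef_vecMulVec_self_star _)).exists_eq_conjTranspose_mul_self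
  have hD : ∀ (b b' : B) (c c' : C), D.map (Matrix.single b b' 1) c c' =
      ∑ k, star (Y k (e b, c)) * Y k (e b', c') := by
    intro b b' c c'
    have h := congrFun (congrFun hY (e b, c)) (e b', c')
    rw [Matrix.mul_apply] at h
    simp only [Matrix.conjTranspose_apply] at h
    rw [← h]
    simp only [idTensor, Matrix.of_apply]
    refine congrFun (congrFun (congrArg D.map ?_) c) c'
    ext i j
    simp [Ω, Matrix.vecMulVec_apply, Matrix.single_apply, ite_and]
    split_ifs <;> rfl
  refine ⟨_, inferInstance, fun k => Matrix.of fun c b => star (Y k (e b, c)), fun X => ?_⟩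
  ext ⟨a, c⟩ ⟨a', c'⟩
  have hX : (Matrix.of fun b b' => X (a, b) (a', b')) =
      ∑ b, ∑ b', X (a, b) (a', b') • Matrix.single b b' (1 : ℂ) := by
    conv_lhs => rw [Matrix.matrix_eq_sum_single (Matrix.of fun b b' => X (a, b) (a', b'))]
    simp [Matrix.smul_single]
  simp only [idTensor, Matrix.of_apply, hX, map_sum, map_smul, Matrix.sum_apply, Matrix.smul_apply,
    hD, localConj_apply, Matrix.one_apply, smul_eq_mul]
  simp only [ite_mul, one_mul, zero_mul, Finset.sum_ite_irrel, Finset.sum_const_zero,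
    Finset.sum_ite_eq, Finset.mem_univ, if_true, apply_ite star, star_one, star_zero, mul_ite,
    mul_zero, star_star, Finset.mul_sum, Finset.sum_mul]
  rw [Finset.sum_comm]
  refine Eq.trans ?_ Finset.sum_comm
  refine Finset.sum_congr rfl fun b' _ => ?_
  rw [Finset.sum_comm]
  refine Finset.sum_congr rfl fun k _ => Finset.sum_congr rfl fun b _ => by ring

/-- The reduced operator on the first system. -/
def reduceFst {A C : Type} [Fintype C] (ω : Matrix (A × C) (A × C) ℂ) : Matrix A A ℂ :=
  Matrix.of fun a a' => ∑ c, ω (a, c) (a', c)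

theorem reduceFst_idTensor {A B C : Type} [Fintype B] [Fintype C] (D : QuantumChannel B C)
    (X : Matrix (A × B) (A × B) ℂ) : reduceFst (idTensor A D.map X) = reduceFst X := by
  ext a a'
  exact D.tracePreserving (Matrix.of fun b b' => X (a, b) (a', b'))

/-- Bob projects onto the span of `|c⟩` and `|c'⟩`, and Alice filters with the matching two blocks
of `v`. The diagonal terms of the defect pair a block of `v` with a different block of `ω` and sum
to `ω_A ⊗ 1`; the coherences sum to `ω`. The factor `2` comes from the symmetry between `c` and
`c'`. -/
theorem sum_fidelityDefect {A C : Type} [Fintype A] [Fintype C] [DecidableEq C]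
    (ω : Matrix (A × C) (A × C) ℂ) (v : A × C → ℂ) :
    ∑ c, ∑ c', fidelityDefect (localConj
      (Matrix.of fun s a => v (a, ![c, c'] s))
      ((1 : Matrix C C ℂ).submatrix ![c, c'] id) ω) =
      2 * (v ⬝ᵥ (((reduceFst ω ⊗ₖ (1 : Matrix C C ℂ)) - ω) *ᵥ star v)) := by
  have key : ∀ (c c' : C) (s t s' t' : Fin 2), localConj
      (Matrix.of fun s a => v (a, ![c, c'] s)) ((1 : Matrix C C ℂ).submatrix ![c, c'] id) ω
        (s, t) (s', t') = ∑ a', ∑ a, v (a, ![c, c'] s) * ω (a, ![c, c'] t) (a', ![c, c'] t') *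
          star (v (a', ![c, c'] s')) := by
    intro c c' s t s' t'
    rw [localConj_apply]
    simp only [Matrix.of_apply, Matrix.submatrix_apply, id_eq, Matrix.one_apply, apply_ite star,
      star_one, star_zero, mul_ite, mul_one, mul_zero, ite_mul, zero_mul, Finset.sum_ite_eq,
      Finset.mem_univ, if_true, Finset.sum_mul]
  have h1 : v ⬝ᵥ ((reduceFst ω ⊗ₖ (1 : Matrix C C ℂ)) *ᵥ star v) =
      ∑ c, ∑ c', ∑ a', ∑ a, v (a, c) * ω (a, c') (a', c') * star (v (a', c)) := by
    simp only [Matrix.mulVec, dotProduct, Fintype.sum_prod_type, reduceFst,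
      Matrix.kroneckerMap_apply, Matrix.of_apply, Matrix.one_apply, mul_ite, mul_one, mul_zero, ite_mul,
      zero_mul, Finset.sum_ite_eq, Finset.mem_univ, if_true, Pi.star_apply, Finset.mul_sum,
      Finset.sum_mul, ← mul_assoc]
    rw [Finset.sum_comm]
    refine Finset.sum_congr rfl fun c _ => ?_
    rw [Finset.sum_comm_cycle]
    exact Finset.sum_congr rfl fun c' _ => Finset.sum_comm
  have h2 : v ⬝ᵥ (ω *ᵥ star v) =
      ∑ c, ∑ c', ∑ a', ∑ a, v (a, c) * ω (a, c) (a', c') * star (v (a', c')) := by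
    simp only [Matrix.mulVec, dotProduct, Fintype.sum_prod_type, Pi.star_apply,
      Finset.mul_sum, ← mul_assoc]
    rw [Finset.sum_comm]
    refine Finset.sum_congr rfl fun c _ => ?_
    rw [Finset.sum_comm_cycle]
    exact Finset.sum_congr rfl fun c' _ => Finset.sum_comm
  rw [Matrix.sub_mulVec, dotProduct_sub, h1, h2, two_mul]
  nth_rewrite 3 [Finset.sum_comm]
  nth_rewrite 4 [Finset.sum_comm]
  simp only [fidelityDefect, key, Matrix.cons_val_zero, Matrix.cons_val_one]
  simp only [Finset.sum_add_distrib, Finset.sum_sub_distrib]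
  ring

/-- The reduction criterion, tested on positive operators. -/
theorem trace_mul_le_of_fidelityDefect_nonneg {A C : Type} [Fintype A] [DecidableEq A] [Fintype C]
    [DecidableEq C] {ω : Matrix (A × C) (A × C) ℂ}
    (h : ∀ (K : Matrix (Fin 2) A ℂ) (Q : Matrix (Fin 2) C ℂ),
      0 ≤ (fidelityDefect (localConj K Q ω)).re)
    {M : Matrix (A × C) (A × C) ℂ} (hM : M.PosSemidef) :
    (M * ω).trace.re ≤ (M * (reduceFst ω ⊗ₖ (1 : Matrix C C ℂ))).trace.re := by
  obtain ⟨Y, rfl⟩ := hM.exists_eq_conjTranspose_mul_self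
  rw [← sub_nonneg, ← Complex.sub_re, ← Matrix.trace_sub, ← Matrix.mul_sub, Matrix.mul_assoc,
    Matrix.trace_mul_comm, Matrix.trace, Complex.re_sum]
  refine Finset.sum_nonneg fun k _ => ?_
  have h1 : (Y * (reduceFst ω ⊗ₖ (1 : Matrix C C ℂ) - ω) * Yᴴ).diag k =
      Y k ⬝ᵥ (((reduceFst ω ⊗ₖ (1 : Matrix C C ℂ)) - ω) *ᵥ star (Y k)) := by
    rw [Matrix.mul_assoc]
    rfl
  have h2 := congrArg Complex.re (sum_fidelityDefect ω (Y k))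
  have h3 : (2 : ℂ) = ((2 : ℝ) : ℂ) := by norm_num
  rw [h3, Complex.re_ofReal_mul, Complex.re_sum] at h2
  have h4 : 0 ≤ ∑ c, (∑ c', fidelityDefect (localConj (Matrix.of fun s a => Y k (a, ![c, c'] s))
      ((1 : Matrix C C ℂ).submatrix ![c, c'] id) ω)).re :=
    Finset.sum_nonneg fun c _ => by
      rw [Complex.re_sum]
      exact Finset.sum_nonneg fun c' _ => h _ _
  rw [h1]
  linarith

/-- Local processing of an undistillable state does not lead to a violation of the reduction
criterion. -/
theorem trace_mul_idTensor_le {A B C : Type} [Fintype A] [DecidableEq A] [Fintype B]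
    [DecidableEq B] [Fintype C] [DecidableEq C] {ρ : Matrix (A × B) (A × B) ℂ} (hρ : IsDensity ρ)
    (h : ¬ IsDistillable ρ) (D : QuantumChannel B C) {M : Matrix (A × C) (A × C) ℂ}
    (hM : M.PosSemidef) :
    (M * idTensor A D.map ρ).trace.re ≤
      (M * (reduceFst ρ ⊗ₖ (1 : Matrix C C ℂ))).trace.re := by
  rw [← reduceFst_idTensor D]
  refine trace_mul_le_of_fidelityDefect_nonneg (fun K Q => ?_) hM
  obtain ⟨ι, _, E, hE⟩ := D.exists_kraus A
  rw [hE, localConj_sum, fidelityDefect_sum, Complex.re_sum]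
  refine Finset.sum_nonneg fun k _ => ?_
  -- Each Kraus operator merges with the filter `Q` into a single filter acting on `ρ` itself.
  rw [localConj_localConj]
  exact fidelityDefect_localConj_nonneg hρ h _ _

/-! ### Bounding the mutual information -/

/-- If the conditional distributions `W x` are all dominated by a measure `s` of mass `d`, then the
mutual information is at most `log d`. -/
theorem mutualInformation_le_logb {X Y : Type} [Fintype X] [Fintype Y] (p : X → ℝ)
    (hp : ∀ x, 0 ≤ p x) (hp1 : ∑ x, p x = 1) (W : X → Y → ℝ) (hW : ∀ x y, 0 ≤ W x y)
    (hW1 : ∀ x, ∑ y, W x y = 1) (s : Y → ℝ) (hWs : ∀ x y, W x y ≤ s y) {d : ℝ} (hd : 0 < d)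
    (hs : ∑ y, s y = d) :
    mutualInformation (fun z : X × Y => p z.1 * W z.1 z.2) ≤ Real.logb 2 d := by
  have hl2 : 0 < Real.log 2 := Real.log_pos one_lt_two
  set Q : Y → ℝ := fun y => ∑ x, p x * W x y with hQ
  have hQ0 : ∀ y, 0 ≤ Q y := fun y => Finset.sum_nonneg fun x _ => mul_nonneg (hp x) (hW x y)
  have hQ1 : ∑ y, Q y = 1 := by
    rw [hQ, Finset.sum_comm]
    simp only [← Finset.mul_sum, hW1, mul_one, hp1]
  have hX : ∀ x, ∑ y, p x * W x y = p x := fun x => by rw [← Finset.mul_sum, hW1, mul_one]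
  -- The summand is `p W log (W / Q)`. Here `W` is replaced by `s` inside the logarithm, and `log u
  -- ≤ u - 1` is applied to `u = s / (d Q)`, as in the proof that the relative entropy of `Q` to `s
  -- / d` is nonnegative.
  have hterm : ∀ x y, p x * W x y * Real.log (p x * W x y) - p x * W x y * Real.log (p x)
      - p x * W x y * Real.log (Q y) ≤
      p x * W x y * Real.log d + p x * W x y * (s y / (d * Q y) - 1) := by
    intro x y
    rcases (mul_nonneg (hp x) (hW x y)).eq_or_lt with h0 | h0
    · simp [← h0]
    · have hpx : 0 < p x := pos_of_mul_pos_left h0 (hW x y)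
      have hWx : 0 < W x y := pos_of_mul_pos_right h0 (hp x)
      have hsy : 0 < s y := hWx.trans_le (hWs x y)
      have hQy : 0 < Q y := h0.trans_le
        (Finset.single_le_sum (f := fun x => p x * W x y)
          (fun x _ => mul_nonneg (hp x) (hW x y)) (Finset.mem_univ x))
      have h1 := Real.log_le_log hWx (hWs x y)
      have h2 := Real.log_le_sub_one_of_pos (div_pos hsy (mul_pos hd hQy))
      rw [Real.log_div hsy.ne' (mul_pos hd hQy).ne', Real.log_mul hd.ne' hQy.ne'] at h2
      rw [Real.log_mul hpx.ne' hWx.ne', ← mul_sub, ← mul_sub, ← mul_add]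
      exact mul_le_mul_of_nonneg_left (by linarith) h0.le
  have hsum : ∑ y, Q y * (s y / (d * Q y) - 1) ≤ 0 := by
    -- Equality holds unless `Q y = 0`, where the left side vanishes and `s y / d` may be positive.
    have h1 : ∀ y, Q y * (s y / (d * Q y) - 1) ≤ s y / d - Q y := by
      intro y
      have hsy : 0 ≤ s y := by
        by_contra hneg
        have hx : ∀ x, p x = 0 := fun x => absurd ((hW x y).trans (hWs x y)) hneg
        simp [hx] at hp1
      rcases (hQ0 y).eq_or_lt with h0 | h0
      · rw [← h0]
        simpa using div_nonneg hsy hd.le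
      · refine le_of_eq ?_
        field_simp
    refine (Finset.sum_le_sum fun y _ => h1 y).trans_eq ?_
    rw [Finset.sum_sub_distrib, ← Finset.sum_div, hs, hQ1, div_self hd.ne', sub_self]
  have hH : mutualInformation (fun z : X × Y => p z.1 * W z.1 z.2) * Real.log 2 =
      ∑ x, ∑ y, (p x * W x y * Real.log (p x * W x y) - p x * W x y * Real.log (p x)
        - p x * W x y * Real.log (Q y)) := by
    have h1 : ∑ x, ∑ y, p x * W x y * Real.log (p x) = ∑ x, p x * Real.log (p x) := by
      simp only [← Finset.sum_mul, hX]
    have h2 : ∑ x, ∑ y, p x * W x y * Real.log (Q y) = ∑ y, Q y * Real.log (Q y) := by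
      rw [Finset.sum_comm]
      simp only [← Finset.sum_mul, hQ]
    simp only [Finset.sum_sub_distrib, h1, h2]
    simp only [mutualInformation, shannonEntropy, hX, Fintype.sum_prod_type, Real.logb,
      ← mul_div_assoc, ← Finset.sum_div]
    field_simp
    ring
  rw [Real.logb, le_div_iff₀ hl2, hH]
  refine (Finset.sum_le_sum fun x _ => Finset.sum_le_sum fun y _ => hterm x y).trans ?_
  simp only [Finset.sum_add_distrib]
  rw [Finset.sum_comm (f := fun x y => p x * W x y * (s y / (d * Q y) - 1))]
  simp only [← Finset.sum_mul, hX, hp1, one_mul]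
  exact add_le_of_nonpos_right hsum

-- Outcome probabilities of signal states, and the corollary.

theorem trace_idTensor {A B C : Type} [Fintype A] [Fintype B] [Fintype C] (D : QuantumChannel B C)
    (X : Matrix (A × B) (A × B) ℂ) : (idTensor A D.map X).trace = X.trace := by
  simp only [Matrix.trace, Fintype.sum_prod_type]
  exact Finset.sum_congr rfl fun a _ =>
    D.tracePreserving (Matrix.of fun b b' => X (a, b) (a, b'))

theorem posSemidef_idTensor {A B C : Type} [Fintype A] [DecidableEq A] [Fintype B] [DecidableEq B]
    [Fintype C] [DecidableEq C] (D : QuantumChannel B C) {X : Matrix (A × B) (A × B) ℂ}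
    (hX : X.PosSemidef) : (idTensor A D.map X).PosSemidef := by
  obtain ⟨ι, _, E, hE⟩ := D.exists_kraus A
  rw [hE]
  exact Matrix.posSemidef_sum _ fun k _ => hX.localConj _ _

theorem Matrix.PosSemidef.trace_mul_re_nonneg {S : Type} [Fintype S] [DecidableEq S]
    {M N : Matrix S S ℂ} (hM : M.PosSemidef) (hN : N.PosSemidef) : 0 ≤ (M * N).trace.re := by
  obtain ⟨Y, rfl⟩ := hM.exists_eq_conjTranspose_mul_self
  rw [Matrix.mul_assoc, Matrix.trace_mul_comm]
  exact (Complex.le_def.mp (hN.mul_mul_conjTranspose_same Y).trace_nonneg).1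

theorem POVM.sum_trace_mul {Y S : Type} [Fintype Y] [Fintype S] [DecidableEq S] (M : POVM Y S)
    (X : Matrix S S ℂ) : ∑ y, (M.effect y * X).trace.re = X.trace.re := by
  rw [← Complex.re_sum, ← Matrix.trace_sum, ← Matrix.sum_mul, M.sum_eq_one, Matrix.one_mul]

theorem trace_reduceFst {A C : Type} [Fintype A] [Fintype C] (ω : Matrix (A × C) (A × C) ℂ) :
    (reduceFst ω).trace = ω.trace := by
  simp [Matrix.trace, reduceFst, Fintype.sum_prod_type]

theorem mainTheorem8 {A B C : Type} [Fintype A] [DecidableEq A] [Fintype B] [DecidableEq B]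
    [Fintype C] [DecidableEq C] {N : ℕ} (P : DenseCodingProtocol A B C N)
    (hρ : IsBoundEntangled P.ρ)
    (p : Fin N → ℝ) (hp : ∀ i, 0 ≤ p i) (hp_sum : ∑ i, p i = 1) :
    BddAbove (measuredInformationValues p P.signal) ∧
      accessibleInformation p P.signal ≤ Real.logb 2 (Fintype.card C) := by
  have htr : ∀ i, (P.signal i).trace = 1 := fun i =>
    (trace_idTensor (P.encoder i) P.ρ).trans P.isDensity.2
  -- There is at least one message since `p` sums to one, and its signal state has trace one, so `C`
  -- is not the zero space.
  have hC : 0 < Fintype.card C := by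
    rw [Fintype.card_pos_iff]
    by_contra hC
    rw [not_nonempty_iff] at hC
    rcases N with _ | N
    · simp at hp_sum
    · have h := htr 0
      simp [Matrix.trace] at h
  have bound : ∀ I ∈ measuredInformationValues p P.signal,
      I ≤ Real.logb 2 (Fintype.card C) := by
    rintro _ ⟨k, M, rfl⟩
    refine mutualInformation_le_logb p hp hp_sum
      (fun i y => (M.effect y * P.signal i).trace.re)
      (fun i y => (M.posSemidef y).trace_mul_re_nonneg
        (posSemidef_idTensor (P.encoder i) P.isDensity.1))
      (fun i => by rw [M.sum_trace_mul, htr, Complex.one_re])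
      (fun y => (M.effect y * (reduceFst P.ρ ⊗ₖ (1 : Matrix C C ℂ))).trace.re)
      (fun i y => trace_mul_idTensor_le P.isDensity hρ.2.2 (P.encoder i) (M.posSemidef y))
      (Nat.cast_pos.mpr hC) ?_
    rw [M.sum_trace_mul, Matrix.trace_kronecker, trace_reduceFst, P.isDensity.2, Matrix.trace_one,
      one_mul, Complex.natCast_re]
  -- `Real.sSup_le` also asks for a nonnegative bound, since the supremum of the empty set is `0`;
  -- here `d ≥ 1` provides it.
  exact ⟨⟨_, bound⟩, Real.sSup_le bound
    (Real.logb_nonneg one_lt_two (Nat.one_le_cast.mpr hC))⟩
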